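/- **Theorem 6.2.** Let $H, U, U_1, U_2$ be (real or complex) Hilbert spaces, and let $A:\mathscr D(A)\subset H\to H$ be a self-adjoint positive definite operator with compact resolvent. Let $B\in\mathscr L(U,H)$, let $\pi:U_1\times U_2\to U$ be a linear isomorphism (continuous with continuous inverse), and let $B_1\in\mathscr L(U_1,H)$, $B_2\in\mathscr L(U_2,H)$ be the operators such that $B\pi(v_1,v_2)=B_1v_1+B_2v_2$ for all $(v_1,v_2)\in U_1\times U_2$. Assume that the system $y'+Ay=Bu$ is null-controllable in arbitrarily small times: for every $T>0$ there is a constant $C_T$ such that for every $y_0\in H$ there is $u\in L^2(0,T;U)$ with $\|u\|_{L^2(0,T;U)}\le C_T\|y_0\|_H$ for which the solution $y$ of $y'+Ay=Bu$ on $(0,T)$, $y(0)=y_0$, satisfies $y(T)=0$. Assume moreover that there are functions $(\rho_T)_{T>0}$ with $\rho_T\in L^1_{loc}(0,T)$ and $\rho_T>0$ a.e. on $(0,T)$ such that for every $T>0$ and every $z_T\in H$ the solution $z$ of $-z'+A^*z=0$ on $(0,T)$, $z(T)=z_T$, satisfies $$\int_0^T\rho_T(t)^2\|z(t)\|_H^2\,dt\le\int_0^T\|B^*z(t)\|_U^2\,dt.$$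 Then for every $T>0$, every $y_0\in H$ and every $f\in L^2(0,T;H)$ with $$\int_0^T\frac{1}{\rho_T(t)^2}\|f(t)\|_H^2\,dt<\infty,$$ there exist $u_1\in L^2(0,T;U_1)$ and $u_2\in L^2(0,T;U_2)$ such that $$\|u_1(t)\|_{U_1}\|u_2(t)\|_{U_2}=0\quad\text{for a.e. }t\in(0,T),$$ and the solution $y$ of $$y'+Ay=B_1u_1+B_2u_2+f\ \text{ on }(0,T),\qquad y(0)=y_0,$$ satisfies $y(T)=0$. Here the solution of $y'+Ay=g$, $y(0)=y_0$, with $g\in L^2(0,T;H)$, is the function $y\in C([0,T];H)$ with $y(0)=y_0$ and $\langle y(t),\varphi\rangle=\langle y_0,\varphi\rangle+\int_0^t\big(\langle g(s),\varphi\rangle-\langle y(s),A^*\varphi\rangle\big)ds$ for all $\varphi\in\mathscr D(A^*)$ and $t\in[0,T]$; likewise the solution of $-z'+A^*z=0$, $z(T)=z_T$, is the $z\in C([0,T];H)$ with $z(T)=z_T$ and $\langle z(t),\varphi\rangle=\langle z_T,\varphi\rangle-\int_t^T\langle z(s),A\varphi\rangle\,ds$ for all $\varphi\in\mathscr D(A)$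 and $t\in[0,T]$. -/

import Mathlib

open Set MeasureTheory
open scoped ENNReal NNReal InnerProductSpace

namespace SwitchingControl

variable {𝕜 H : Type*} [RCLike 𝕜] [NormedAddCommGroup H] [InnerProductSpace 𝕜 H]

/-- The (possibly unbounded) operator `A` is positive definite: `⟨A x, x⟩ > 0` for all
nonzero `x` in the domain. -/
def IsPosDef (A : H →ₗ.[𝕜] H) : Prop :=
  ∀ x : A.domain, (x : H) ≠ 0 → 0 < RCLike.re (inner 𝕜 (A x) (x : H))

/-- `A` has compact resolvent: for some scalar `μ`, the map `A - μ : D(A) → H` is bijective and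
its inverse `R`, seen as a map from `H` to `H`, is a compact bounded operator. -/
def HasCompactResolvent (A : H →ₗ.[𝕜] H) : Prop :=
  ∃ (μ : 𝕜) (R : H →L[𝕜] H), IsCompactOperator R ∧
    (∀ x : H, ∃ hx : R x ∈ A.domain, A ⟨R x, hx⟩ - μ • R x = x) ∧
    (∀ x : A.domain, R (A x - μ • (x : H)) = (x : H))

variable [CompleteSpace H]

/-- `y` is the solution on `[0,T]` of `y' + A y = g`, `y(0) = y₀`: it is continuous with values
in `H` and satisfies the equation weakly, that is, tested against the elements of `D(A*)` and
integrated in time. -/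
structure IsSolution (A : H →ₗ.[𝕜] H) (T : ℝ) (g : ℝ → H) (y₀ : H) (y : ℝ → H) : Prop where
  continuousOn : ContinuousOn y (Icc 0 T)
  initial : y 0 = y₀
  weak : ∀ φ : A.adjoint.domain, ∀ t ∈ Icc 0 T,
    inner 𝕜 (φ : H) (y t) = inner 𝕜 (φ : H) y₀ +
      ∫ s in (0 : ℝ)..t, (inner 𝕜 (φ : H) (g s) - inner 𝕜 (A.adjoint φ) (y s))

/-- The solution of `y' + A y = g`, `y(0) = y₀` on `[0,T]` exists and vanishes at time `T`. -/
def DrivesToZero (A : H →ₗ.[𝕜] H) (T : ℝ) (g : ℝ → H) (y₀ : H) : Prop :=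
  (∃ y : ℝ → H, IsSolution A T g y₀ y) ∧ ∀ y : ℝ → H, IsSolution A T g y₀ y → y T = 0

variable {U : Type*} [NormedAddCommGroup U] [InnerProductSpace 𝕜 U]

/-- The system `y' + A y = B u` is null-controllable in arbitrarily small times: for all `T > 0`
there is a constant `C` such that every `y₀` is driven to zero at time `T` by some
`u ∈ L²(0,T;U)` with `‖u‖_{L²(0,T;U)} ≤ C ‖y₀‖`. -/
def NullControllableSmallTime (A : H →ₗ.[𝕜] H) (B : U →L[𝕜] H) : Prop :=
  ∀ T : ℝ, 0 < T → ∃ C : ℝ≥0, ∀ y₀ : H, ∃ u : ℝ → U,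
    MemLp u 2 (volume.restrict (Ioo 0 T)) ∧
    eLpNorm u 2 (volume.restrict (Ioo 0 T)) ≤ C * ‖y₀‖ₑ ∧
    DrivesToZero A T (fun t => B (u t)) y₀

/-- `z` is the solution on `[0,T]` of the adjoint problem `-z' + A* z = 0`, `z(T) = z_T`: it is
continuous with values in `H` and satisfies the equation weakly, that is, tested against the
elements of `D(A)` and integrated in time. -/
structure IsAdjointSolution (A : H →ₗ.[𝕜] H) (T : ℝ) (zT : H) (z : ℝ → H) : Prop where
  continuousOn : ContinuousOn z (Icc 0 T)
  final : z T = zT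
  weak : ∀ φ : A.domain, ∀ t ∈ Icc 0 T,
    inner 𝕜 (φ : H) (z t) = inner 𝕜 (φ : H) zT - ∫ s in t..T, inner 𝕜 (A φ) (z s)

variable [CompleteSpace U]

/-- The weighted observability inequality on `(0,T)`: for all `z_T ∈ H`, the solution `z` of the
adjoint problem satisfies `∫₀ᵀ ρ(t)² ‖z(t)‖² dt ≤ ‖B* z‖²_{L²(0,T;U)}`. -/
def WeightedObservability (A : H →ₗ.[𝕜] H) (B : U →L[𝕜] H) (T : ℝ) (ρ : ℝ → ℝ) : Prop :=
  ∀ (zT : H) (z : ℝ → H), IsAdjointSolution A T zT z →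
    ∫⁻ t in Ioo 0 T, ENNReal.ofReal (ρ t ^ 2) * ‖z t‖ₑ ^ 2 ≤
      ∫⁻ t in Ioo 0 T, ‖ContinuousLinearMap.adjoint B (z t)‖ₑ ^ 2

end SwitchingControl

/-!
Existence of switching controls for a self-adjoint positive definite `A` with compact resolvent.

By the Fredholm alternative `A⁻¹` is compact, so `A` is diagonal in a Hilbert basis
(`exists_hilbertBasis_eigenvalues`). This gives the semigroup `S(s) = exp (-s A)` explicitly
(`heatOp`), its analyticity for `s > 0` (`analyticOnNhd_heatOp`), and the identification of weak
solutions with the Duhamel formula (`drivesToZero_iff`). Being driven to zero is then equivalent to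
orthogonality of the final state to every `z`, which is an identity between the controls and the
observation `t ↦ B* S(T - t) z`.

Write `w₁`, `w₂` for the components of an observation `w` through `π*`. The controls come from
minimizing `∫ max (‖w₁(t)‖², (T + t) ‖w₂(t)‖²) dt - 2 L w` over the closure in `L²(0, T; U)` of the
space of observations. The linear form `L`, which encodes `y₀` and `f`, is bounded there, for `y₀`
by the observability inequality dual to null-controllability and for `f` by the weighted one
(`exists_norm_inner_mildSolution_le`). Where the two terms in the maximum differ, its derivative
involves only one component, so the Euler–Lagrange equation yields a pair of controls of which at
most one is active (`exists_switching_representation`).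

It remains to exclude ties. By observability in arbitrarily small times, an element of the closure
is still of the form `t ↦ B* h(T - t)` with `h` analytic on `(0, ∞)`
(`exists_trajectory_of_mem_closure`). With `s = T - t` the weight is `2 T - s`; if ties occurred on a
set of positive measure, `‖w₁‖² = (2 T - s) ‖w₂‖²` would hold for all `s > 0` by analyticity, but the
weight is negative for `s > 2 T`, so both components would vanish (`ae_ne_or_eq_zero_of_analytic`).
-/

/-! ### Diagonalization -/

open Module.End in
/-- A compact symmetric operator on a Hilbert space admits a Hilbert basis of eigenvectors. -/
theorem exists_hilbertBasis_eigenvectors.{u, v} {𝕜 : Type u} {H : Type v} [RCLike 𝕜]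
    [NormedAddCommGroup H] [InnerProductSpace 𝕜 H] [CompleteSpace H]
    (K : H →L[𝕜] H) (hK : IsCompactOperator K) (hs : (K : H →ₗ[𝕜] H).IsSymmetric) :
    ∃ (ι : Type max u v) (b : HilbertBasis ι 𝕜 H) (κ : ι → 𝕜), ∀ i, K (b i) = κ i • b i := by
  have hcl : ∀ μ : 𝕜, IsClosed (eigenspace (K : H →ₗ[𝕜] H) μ : Set H) := fun μ => by
    have : (eigenspace (K : H →ₗ[𝕜] H) μ : Set H) = {x | K x = μ • x} := by
      ext x; simp
    rw [this]
    exact isClosed_eq K.continuous (continuous_const_smul μ)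
  have : ∀ μ : 𝕜, CompleteSpace (eigenspace (K : H →ₗ[𝕜] H) μ) :=
    fun μ => (hcl μ).completeSpace_coe
  choose w bw hbw using fun μ : 𝕜 => exists_hilbertBasis 𝕜 (eigenspace (K : H →ₗ[𝕜] H) μ)
  have hv := hs.orthogonalFamily_eigenspaces.orthonormal_sigma_orthonormal
    (fun μ => (bw μ).orthonormal)
  set v : (Σ μ : 𝕜, w μ) → H :=
    fun a => (eigenspace (K : H →ₗ[𝕜] H) a.1).subtypeₗᵢ (bw a.1 a.2)
  have hperp : (Submodule.span 𝕜 (Set.range v))ᗮ = ⊥ := by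
    rw [eq_bot_iff,
      ← ContinuousLinearMap.orthogonalComplement_iSup_eigenspaces_eq_bot hK hs]
    rw [← Submodule.orthogonal_closure]
    refine Submodule.orthogonal_le ?_
    refine iSup_le fun μ x hx => ?_
    have h1 := (bw μ).dense_span
    have h2 : (⟨x, hx⟩ : eigenspace (K : H →ₗ[𝕜] H) μ) ∈
        (Submodule.span 𝕜 (Set.range (bw μ))).topologicalClosure := by rw [h1]; trivial
    have h3 := map_mem_closure (f := (Subtype.val : eigenspace (K : H →ₗ[𝕜] H) μ → H))
      (t := (Submodule.span 𝕜 (Set.range v) : Set H)) continuous_subtype_val h2 ?_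
    · exact h3
    · intro y hy
      have : Submodule.span 𝕜 (Set.range (bw μ)) ≤
          (Submodule.span 𝕜 (Set.range v)).comap (eigenspace (K : H →ₗ[𝕜] H) μ).subtype := by
        rw [Submodule.span_le]
        rintro _ ⟨j, rfl⟩
        exact Submodule.subset_span ⟨⟨μ, j⟩, rfl⟩
      exact this hy
  refine ⟨_, HilbertBasis.mkOfOrthogonalEqBot hv hperp, fun a => a.1, fun a => ?_⟩
  rw [HilbertBasis.coe_mkOfOrthogonalEqBot]
  exact mem_eigenspace_iff.mp (bw a.1 a.2).2

/-- A positive definite self-adjoint operator with compact resolvent has a Hilbert basis of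
eigenvectors with positive eigenvalues. By the Fredholm alternative, injectivity of `A` makes
`A⁻¹ = R (1 + μ R)⁻¹` a compact operator for any resolvent `R = (A - μ)⁻¹`. -/
theorem exists_hilbertBasis_eigenvalues.{u, v} {𝕜 : Type u} {H : Type v} [RCLike 𝕜]
    [NormedAddCommGroup H] [InnerProductSpace 𝕜 H] [CompleteSpace H]
    {A : H →ₗ.[𝕜] H} (hA : A.IsFormalAdjoint A)
    (hpos : SwitchingControl.IsPosDef A) (hres : SwitchingControl.HasCompactResolvent A) :
    ∃ (ι : Type max u v) (b : HilbertBasis ι 𝕜 H) (lam : ι → ℝ), (∀ i, 0 < lam i) ∧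
      ∀ i, ∃ h : b i ∈ A.domain, A ⟨b i, h⟩ = (lam i : 𝕜) • b i := by
  obtain ⟨μ, R, hR, hR1, hR2⟩ := hres
  have hinj : ∀ x : A.domain, A x = 0 → (x : H) = 0 := fun x hx => by
    by_contra h
    have := hpos x h
    simp [hx] at this
  -- On the kernel of `1 + μ R` one has `A (R x) = x + μ R x = 0`, hence `R x = 0` and `x = 0`.
  have hunit : IsUnit (1 + μ • R : H →L[𝕜] H) := by
    by_cases hμ : μ = 0
    · simp [hμ]
    rcases hR.hasEigenvalue_or_mem_resolventSet (μ := -μ⁻¹) (by simpa using hμ) with h | h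
    · obtain ⟨x, hx⟩ := h.exists_hasEigenvector
      have h0 : R x = -μ⁻¹ • x := hx.apply_eq_smul
      obtain ⟨hd, he⟩ := hR1 x
      have h1 : A ⟨R x, hd⟩ = 0 := by
        rw [sub_eq_iff_eq_add.mp he, h0, smul_smul]; simp [hμ]
      have h2 := hinj _ h1
      simp only [h0] at h2
      exact absurd ((smul_eq_zero.mp h2).resolve_left (by simpa using hμ)) hx.2
    · have h3 : (1 + μ • R : H →L[𝕜] H) =
          (-μ) • (algebraMap 𝕜 (H →L[𝕜] H) (-μ⁻¹) - R) := by
        rw [smul_sub, Algebra.algebraMap_eq_smul_one, smul_smul]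
        simp [hμ]
      rw [h3]
      exact (isUnit_smul_iff (Units.mk0 (-μ) (by simpa using hμ)) _).mpr h
  obtain ⟨V, hV⟩ := hunit
  set K : H →L[𝕜] H := R ∘L (↑V⁻¹ : H →L[𝕜] H)
  have hKc : IsCompactOperator K := hR.comp_clm _
  have hVV : ∀ x, (↑V⁻¹ : H →L[𝕜] H) x + μ • R ((↑V⁻¹ : H →L[𝕜] H) x) = x := fun x => by
    have h := congrArg (fun W : H →L[𝕜] H => W x) V.mul_inv
    simpa [hV] using h
  have hAK : ∀ x, ∃ h : K x ∈ A.domain, A ⟨K x, h⟩ = x := fun x => by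
    obtain ⟨hd, he⟩ := hR1 ((↑V⁻¹ : H →L[𝕜] H) x)
    exact ⟨hd, (sub_eq_iff_eq_add.mp he).trans (hVV x)⟩
  have hKs : (K : H →ₗ[𝕜] H).IsSymmetric := fun x y => by
    obtain ⟨hx, hx'⟩ := hAK x
    obtain ⟨hy, hy'⟩ := hAK y
    have h := hA ⟨K x, hx⟩ ⟨K y, hy⟩
    rw [hx', hy'] at h
    exact h.symm
  obtain ⟨ι, b, κ, hb⟩ := exists_hilbertBasis_eigenvectors K hKc hKs
  have hbne : ∀ i, b i ≠ 0 := fun i => b.orthonormal.ne_zero i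
  have key : ∀ i, ∃ h : b i ∈ A.domain, A ⟨b i, h⟩ = (κ i)⁻¹ • b i := fun i => by
    obtain ⟨h, h'⟩ := hAK (b i)
    have hκ : κ i ≠ 0 := fun h0 => by
      have : (⟨K (b i), h⟩ : A.domain) = 0 := by ext; simp [hb, h0]
      rw [this, LinearPMap.map_zero] at h'
      exact hbne i h'.symm
    have h1 : b i = (κ i)⁻¹ • K (b i) := by rw [hb, smul_smul, inv_mul_cancel₀ hκ, one_smul]
    have hd : b i ∈ A.domain := by rw [h1]; exact A.domain.smul_mem _ h
    refine ⟨hd, ?_⟩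
    have h2 : (⟨b i, hd⟩ : A.domain) = (κ i)⁻¹ • ⟨K (b i), h⟩ := Subtype.ext h1
    rw [h2, A.map_smul, h']
  have hin : ∀ i, inner 𝕜 (b i) (b i) = (1 : 𝕜) := fun i => by
    simp [inner_self_eq_norm_sq_to_K, b.orthonormal.1 i]
  -- By symmetry of `A` its eigenvalues are real.
  have hreal : ∀ i, ((RCLike.re (κ i)⁻¹ : ℝ) : 𝕜) = (κ i)⁻¹ := fun i => by
    obtain ⟨h, h'⟩ := key i
    have := hA ⟨b i, h⟩ ⟨b i, h⟩
    rw [h'] at this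
    simp only [inner_smul_left, inner_smul_right, hin, mul_one] at this
    exact RCLike.conj_eq_iff_re.mp this
  refine ⟨ι, b, fun i => RCLike.re (κ i)⁻¹, fun i => ?_, fun i => ?_⟩
  · obtain ⟨h, h'⟩ := key i
    have := hpos ⟨b i, h⟩ (hbne i)
    rw [h', inner_smul_left, hin, mul_one, RCLike.conj_re] at this
    exact this
  · rw [hreal]; exact key i

/-! ### The semigroup in an eigenbasis -/

section Semigroup

variable {ι 𝕜 H : Type*} [RCLike 𝕜] [NormedAddCommGroup H] [InnerProductSpace 𝕜 H]

theorem HilbertBasis.ext_inner (b : HilbertBasis ι 𝕜 H) {x y : H}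
    (h : ∀ i, inner 𝕜 (b i) x = inner 𝕜 (b i) y) : x = y := by
  apply b.repr.injective
  ext i
  simpa [b.repr_apply_apply] using h i

/-- The operator that is diagonal in the Hilbert basis `b`, with real diagonal entries `m i` of
absolute value at most one. -/
noncomputable def diagonalOp (b : HilbertBasis ι 𝕜 H) (m : ι → ℝ) (hm : ∀ i, |m i| ≤ 1) :
    H →L[𝕜] H :=
  have hle : ∀ (f : lp (fun _ : ι => 𝕜) 2) i, ‖(m i : 𝕜) * f i‖ ≤ ‖f i‖ := fun f i => by
    rw [norm_mul, RCLike.norm_ofReal]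
    exact mul_le_of_le_one_left (norm_nonneg _) (hm i)
  have hmem : ∀ f : lp (fun _ : ι => 𝕜) 2, Memℓp (fun i => (m i : 𝕜) * f i) 2 := fun f =>
    (lp.memℓp f).mono' (hle f)
  LinearMap.mkContinuous
    { toFun := fun x => b.repr.symm ⟨_, hmem (b.repr x)⟩
      map_add' := fun x y => by
        rw [← map_add]
        congr 1
        ext i
        simp only [map_add, lp.coeFn_add, Pi.add_apply, mul_add]
      map_smul' := fun c x => by
        rw [RingHom.id_apply, ← map_smul]
        congr 1
        ext i
        simp [mul_left_comm] }
    1 (fun x => by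
      rw [LinearMap.coe_mk, AddHom.coe_mk, LinearIsometryEquiv.norm_map, one_mul,
        ← b.repr.norm_map x]
      exact lp.norm_mono (by simp) (hle (b.repr x)))

variable (b : HilbertBasis ι 𝕜 H)

theorem inner_diagonalOp {m : ι → ℝ} (hm : ∀ i, |m i| ≤ 1) (x : H) (i : ι) :
    inner 𝕜 (b i) (diagonalOp b m hm x) = m i * inner 𝕜 (b i) x := by
  rw [← b.repr_apply_apply, ← b.repr_apply_apply]
  simp [diagonalOp]

theorem norm_diagonalOp_le {m : ι → ℝ} (hm : ∀ i, |m i| ≤ 1) (x : H) :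
    ‖diagonalOp b m hm x‖ ≤ ‖x‖ := by
  have h : ‖diagonalOp b m hm‖ ≤ 1 := by
    unfold diagonalOp
    exact LinearMap.mkContinuous_norm_le _ zero_le_one _
  simpa using (diagonalOp b m hm).le_of_opNorm_le h x

theorem diagonalOp_symmetric {m : ι → ℝ} (hm : ∀ i, |m i| ≤ 1) (x y : H) :
    inner 𝕜 (diagonalOp b m hm x) y = inner 𝕜 x (diagonalOp b m hm y) := by
  rw [← b.tsum_inner_mul_inner, ← b.tsum_inner_mul_inner]
  refine tsum_congr fun i => ?_
  rw [inner_diagonalOp, ← inner_conj_symm, inner_diagonalOp, map_mul, inner_conj_symm,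
    RCLike.conj_ofReal]
  ring

/-- The semigroup `exp (-s A)` of the operator `A` with `A (b i) = lam i • b i`, extended by the
identity to negative times. -/
noncomputable def heatOp {lam : ι → ℝ} (hlam : ∀ i, 0 ≤ lam i) (s : ℝ) : H →L[𝕜] H :=
  diagonalOp b (fun i => Real.exp (-(lam i * max s 0))) fun i => by
    rw [abs_of_pos (Real.exp_pos _), Real.exp_le_one_iff, neg_nonpos]
    exact mul_nonneg (hlam i) (le_max_right _ _)

variable {lam : ι → ℝ} (hlam : ∀ i, 0 ≤ lam i)

theorem inner_heatOp {s : ℝ} (hs : 0 ≤ s) (x : H) (i : ι) :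
    inner 𝕜 (b i) (heatOp b hlam s x) = (Real.exp (-(lam i * s)) : ℝ) * inner 𝕜 (b i) x := by
  rw [heatOp, inner_diagonalOp, max_eq_left hs]

theorem norm_heatOp_le (s : ℝ) (x : H) : ‖heatOp b hlam s x‖ ≤ ‖x‖ :=
  norm_diagonalOp_le _ _ _

theorem heatOp_symmetric (s : ℝ) (x y : H) :
    inner 𝕜 (heatOp b hlam s x) y = inner 𝕜 x (heatOp b hlam s y) :=
  diagonalOp_symmetric _ _ _ _

theorem heatOp_zero (x : H) : heatOp b hlam 0 x = x :=
  b.ext_inner fun i => by simp [inner_heatOp b hlam le_rfl]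

theorem heatOp_add {s r : ℝ} (hs : 0 ≤ s) (hr : 0 ≤ r) (x : H) :
    heatOp b hlam (s + r) x = heatOp b hlam s (heatOp b hlam r x) :=
  b.ext_inner fun i => by
    rw [inner_heatOp b hlam (add_nonneg hs hr), inner_heatOp b hlam hs, inner_heatOp b hlam hr,
      ← mul_assoc, ← RCLike.ofReal_mul, ← Real.exp_add]
    ring_nf

theorem continuous_heatOp_uncurry : Continuous fun p : H × ℝ => heatOp b hlam p.2 p.1 := by
  refine continuous_prod_of_dense_continuous_lipschitzWith _ 1
    (Submodule.dense_iff_topologicalClosure_eq_top.mpr b.dense_span) ?_ ?_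
  · intro x hx
    induction hx using Submodule.span_induction with
    | mem x hx =>
      obtain ⟨j, rfl⟩ := hx
      have : ∀ s, heatOp b hlam s (b j) = ((Real.exp (-(lam j * max s 0)) : ℝ) : 𝕜) • b j :=
        fun s => b.ext_inner fun i => by
          rw [heatOp, inner_diagonalOp, inner_smul_right]
          by_cases hij : i = j
          · rw [hij]
          · rw [b.orthonormal.2 hij, mul_zero, mul_zero]
      simp only [this]
      refine Continuous.smul (RCLike.continuous_ofReal.comp ?_) continuous_const
      fun_prop
    | zero => simpa using continuous_const
    | add x y _ _ hx hy => simpa only [map_add] using! hx.add hy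
    | smul c x _ hx => simpa only [map_smul] using! hx.const_smul c
  · intro s
    refine LipschitzWith.of_dist_le_mul fun x y => ?_
    rw [dist_eq_norm, dist_eq_norm, ← map_sub, NNReal.coe_one, one_mul]
    exact norm_heatOp_le b hlam s _

theorem continuous_heatOp (x : H) : Continuous fun s => heatOp b hlam s x :=
  (continuous_heatOp_uncurry b hlam).comp (by fun_prop : Continuous fun s : ℝ => (x, s))

/-- The semigroup of a nonnegative diagonal operator is analytic for positive times: at `s > 0` the
Taylor coefficients have entries `(-lam i) ^ n / n ! * exp (-lam i * s)`, of size at most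
`s ^ (-n)`. -/
theorem analyticOnNhd_heatOp [CompleteSpace H] [NormedSpace ℝ H] [IsScalarTower ℝ 𝕜 H] (x : H) :
    AnalyticOnNhd ℝ (fun s => heatOp b hlam s x) (Ioi 0) := by
  intro s hs
  have hs : 0 < s := hs
  set m : ℕ → ι → ℝ := fun n i =>
    (lam i * s) ^ n / n.factorial * Real.exp (-(lam i * s)) with hmdef
  have hm : ∀ n i, |m n i| ≤ 1 := fun n i => by
    have h0 : 0 ≤ lam i * s := mul_nonneg (hlam i) hs.le
    rw [abs_of_nonneg (by positivity), hmdef]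
    calc _ ≤ Real.exp (lam i * s) * Real.exp (-(lam i * s)) := by
          
          exact mul_le_mul_of_nonneg_right (Real.pow_div_factorial_le_exp _ h0 n) (Real.exp_pos _).le
      _ = 1 := by rw [← Real.exp_add]; simp
  set c : ℕ → H := fun n => (-s⁻¹) ^ n • diagonalOp b (m n) (hm n) x with hc
  have hcn : ∀ n, ‖c n‖ ≤ ‖x‖ * s⁻¹ ^ n := fun n => by
    rw [hc, norm_smul, norm_pow, norm_neg, norm_inv, Real.norm_of_nonneg hs.le, mul_comm]
    gcongr
    exact norm_diagonalOp_le _ _ _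
  have key : HasFPowerSeriesOnBall (fun s => heatOp b hlam s x)
      (fun n => ContinuousMultilinearMap.mkPiRing ℝ (Fin n) (c n)) s (ENNReal.ofReal s) := by
    refine ⟨?_, by simpa using hs, ?_⟩
    · refine FormalMultilinearSeries.le_radius_of_bound _ ‖x‖ fun n => ?_
      rw [ContinuousMultilinearMap.norm_mkPiRing, Real.coe_toNNReal _ hs.le]
      calc ‖c n‖ * s ^ n ≤ ‖x‖ * s⁻¹ ^ n * s ^ n := by gcongr; exact hcn n
        _ = ‖x‖ := by rw [mul_assoc, ← mul_pow, inv_mul_cancel₀ hs.ne', one_pow, mul_one]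
    · intro y hy
      have hy' : |y| < s := by
        rw [Metric.eball_ofReal, mem_ball_zero_iff] at hy
        exact hy
      have hsy : 0 ≤ s + y := by linarith [(abs_lt.mp hy').1]
      simp only [ContinuousMultilinearMap.mkPiRing_apply, Finset.prod_const, Finset.card_univ,
        Fintype.card_fin]
      have hsum : Summable fun n => y ^ n • c n := by
        refine Summable.of_norm_bounded (g := fun n => ‖x‖ * (|y| / s) ^ n)
          ((summable_geometric_of_lt_one (by positivity) ((div_lt_one hs).mpr hy')).mul_left _)
          fun n => ?_
        rw [norm_smul, norm_pow, Real.norm_eq_abs, div_pow, div_eq_mul_inv, ← inv_pow]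
        calc |y| ^ n * ‖c n‖ ≤ |y| ^ n * (‖x‖ * s⁻¹ ^ n) := by gcongr; exact hcn n
          _ = _ := by ring
      have heq : ∑' n, y ^ n • c n = heatOp b hlam (s + y) x := b.ext_inner fun i => by
        have h1 := (hsum.hasSum).mapL (innerSL 𝕜 (b i))
        refine h1.unique ?_
        simp only [innerSL_apply_apply]
        rw [inner_heatOp b hlam hsy]
        have h2 : HasSum (fun n => (-(lam i * y)) ^ n / n.factorial)
            (Real.exp (-(lam i * y))) := by
          rw [Real.exp_eq_exp_ℝ]
          exact NormedSpace.expSeries_div_hasSum_exp _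
        have h3 := ((RCLike.hasSum_ofReal 𝕜).mpr (h2.mul_right (Real.exp (-(lam i * s))))).mul_right
          (inner 𝕜 (b i) x)
        have h4 : ∀ n, inner 𝕜 (b i) (y ^ n • c n) =
            (((-(lam i * y)) ^ n / n.factorial * Real.exp (-(lam i * s)) : ℝ) : 𝕜) *
              inner 𝕜 (b i) x := fun n => by
          have h5 : (-(lam i * y)) ^ n = (y * -s⁻¹) ^ n * (lam i * s) ^ n := by
            rw [← mul_pow]
            congr 1
            linear_combination (lam i * y) * inv_mul_cancel₀ hs.ne'
          rw [smul_smul, ← algebraMap_smul 𝕜, inner_smul_right, inner_diagonalOp, ← mul_assoc,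
            RCLike.algebraMap_eq_ofReal, ← RCLike.ofReal_mul, h5, mul_pow]
          congr 2
          ring
        simp only [h4]
        have h6 : -(lam i * (s + y)) = -(lam i * y) + -(lam i * s) := by ring
        rw [h6, Real.exp_add]
        exact h3
      rw [← heq]
      exact hsum.hasSum
  exact key.analyticAt

end Semigroup

/-! ### Variation of constants for scalar equations -/

section ScalarEquation

variable {E : Type*} [NormedAddCommGroup E] [NormedSpace ℝ E]

theorem intervalIntegrable_exp_smul (l : ℝ) {h : ℝ → E} {t : ℝ} (u : ℝ)
    (hh : IntervalIntegrable h volume 0 t) :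
    IntervalIntegrable (fun r => Real.exp (-(l * (u - r))) • h r) volume 0 t :=
  hh.continuousOn_smul (f := fun r => Real.exp (-(l * (u - r)))) (by fun_prop)

theorem continuousOn_integral_exp_smul (l : ℝ) {h : ℝ → E} {t : ℝ}
    (hh : IntervalIntegrable h volume 0 t) :
    ContinuousOn (fun s => ∫ r in (0 : ℝ)..s, Real.exp (-(l * (s - r))) • h r) (uIcc 0 t) := by
  have h1 : ∀ s, ∫ r in (0 : ℝ)..s, Real.exp (-(l * (s - r))) • h r =
      Real.exp (-(l * s)) • ∫ r in (0 : ℝ)..s, Real.exp (-(l * (0 - r))) • h r := fun s => by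
    rw [← intervalIntegral.integral_smul]
    refine intervalIntegral.integral_congr fun r _ => ?_
    simp only [smul_smul, ← Real.exp_add]
    ring_nf
  simp only [h1]
  refine ContinuousOn.smul (by fun_prop) ?_
  exact intervalIntegral.continuousOn_primitive_interval' (intervalIntegrable_exp_smul l 0 hh)
    left_mem_uIcc

variable [CompleteSpace E]

theorem integral_mul_exp_neg_mul_sub (l r t : ℝ) :
    ∫ s in r..t, l * Real.exp (-(l * (s - r))) = 1 - Real.exp (-(l * (t - r))) := by
  have h : ∀ s, HasDerivAt (fun s => -Real.exp (-(l * (s - r))))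
      (l * Real.exp (-(l * (s - r)))) s := fun s => by
    have h1 : HasDerivAt (fun s => -(l * (s - r))) (-(l * 1)) s :=
      (((hasDerivAt_id s).sub_const r).const_mul l).neg
    refine h1.exp.neg.congr_deriv ?_
    ring
  rw [intervalIntegral.integral_eq_sub_of_hasDerivAt (fun s _ => h s)
    (Continuous.intervalIntegrable (by fun_prop) _ _)]
  simp
  ring

/-- Fubini on the triangle `0 ≤ r ≤ s ≤ t`. -/
theorem integral_smul_integral_exp_smul (l : ℝ) {h : ℝ → E} {t : ℝ} (ht : 0 ≤ t)
    (hh : IntervalIntegrable h volume 0 t) :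
    ∫ s in (0 : ℝ)..t, l • ∫ r in (0 : ℝ)..s, Real.exp (-(l * (s - r))) • h r =
      ∫ r in (0 : ℝ)..t, (1 - Real.exp (-(l * (t - r)))) • h r := by
  set μ := volume.restrict (Ioc 0 t) with hμ
  have hint : Integrable h μ := (intervalIntegrable_iff_integrableOn_Ioc_of_le ht).mp hh
  -- The kernel, extended by zero outside of the triangle.
  set k : ℝ × ℝ → ℝ := {p : ℝ × ℝ | p.2 ≤ p.1}.indicator
    fun p => l * Real.exp (-(l * (p.1 - p.2))) with hk
  have hms : MeasurableSet {p : ℝ × ℝ | p.2 ≤ p.1} := measurableSet_le measurable_snd measurable_fst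
  have hkm : Measurable k := by
    refine Measurable.indicator ?_ hms
    fun_prop
  have hkI : Integrable (fun p : ℝ × ℝ => k p • h p.2) (μ.prod μ) := by
    refine (hint.comp_snd μ).bdd_smul (|l| * Real.exp (|l| * t)) hkm.aestronglyMeasurable ?_
    rw [hμ, Measure.prod_restrict]
    filter_upwards [ae_restrict_mem (measurableSet_Ioc.prod measurableSet_Ioc)] with p hp
    rw [hk]
    refine (norm_indicator_le_norm_self _ _).trans ?_
    rw [norm_mul, Real.norm_eq_abs, Real.norm_of_nonneg (Real.exp_pos _).le]
    gcongr
    have h1 : |p.1 - p.2| ≤ t := by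
      rw [abs_le]; constructor <;> linarith [hp.1.1, hp.1.2, hp.2.1, hp.2.2]
    calc -(l * (p.1 - p.2)) ≤ |l * (p.1 - p.2)| := neg_le_abs _
      _ = |l| * |p.1 - p.2| := abs_mul _ _
      _ ≤ |l| * t := by gcongr
  calc ∫ s in (0 : ℝ)..t, l • ∫ r in (0 : ℝ)..s, Real.exp (-(l * (s - r))) • h r
      = ∫ s, ∫ r, k (s, r) • h r ∂μ ∂μ := by
        rw [intervalIntegral.integral_of_le ht]
        refine setIntegral_congr_fun measurableSet_Ioc fun s hs => ?_
        have h1 : ∀ r, k (s, r) • h r =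
            (Iic s).indicator (fun r => (l * Real.exp (-(l * (s - r)))) • h r) r := fun r => by
          by_cases hr : r ≤ s <;> simp [hk, hr]
        simp only [h1]
        rw [integral_indicator measurableSet_Iic, hμ, Measure.restrict_restrict measurableSet_Iic,
          intervalIntegral.integral_of_le hs.1.le, ← integral_smul]
        have h2 : Iic s ∩ Ioc 0 t = Ioc 0 s := by
          ext r; simp only [mem_inter_iff, mem_Iic, mem_Ioc]
          exact ⟨fun h => ⟨h.2.1, h.1⟩, fun h => ⟨h.2, h.1, h.2.trans hs.2⟩⟩
        rw [h2]
        simp only [smul_smul]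
    _ = ∫ r, ∫ s, k (s, r) • h r ∂μ ∂μ := integral_integral_swap hkI
    _ = _ := by
        rw [intervalIntegral.integral_of_le ht]
        refine setIntegral_congr_fun measurableSet_Ioc fun r hr => ?_
        have h1 : ∀ s, k (s, r) =
            (Ici r).indicator (fun s => l * Real.exp (-(l * (s - r)))) s := fun s => by
          by_cases hr : r ≤ s <;> simp [hk, hr]
        simp only [h1]
        rw [integral_smul_const, integral_indicator measurableSet_Ici, hμ,
          Measure.restrict_restrict measurableSet_Ici, ← integral_mul_exp_neg_mul_sub,
          intervalIntegral.integral_of_le hr.2, ← integral_Icc_eq_integral_Ioc]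
        have h2 : Ici r ∩ Ioc 0 t = Icc r t := by
          ext s; simp only [mem_inter_iff, mem_Ici, mem_Ioc, mem_Icc]
          exact ⟨fun h => ⟨h.1, h.2.2⟩, fun h => ⟨h.1, hr.1.trans_le h.1, h.2⟩⟩
        rw [h2]

theorem integral_exp_mul_neg (l t : ℝ) :
    ∫ s in (0 : ℝ)..t, l * Real.exp (-(l * s)) = 1 - Real.exp (-(l * t)) := by
  simpa using integral_mul_exp_neg_mul_sub l 0 t

/-- Variation of constants: the Duhamel formula solves `c' + l c = h`, `c 0 = a`, in integrated
form. -/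
theorem duhamel_integral_eq (l : ℝ) (a : E) {h : ℝ → E} {t : ℝ} (ht : 0 ≤ t)
    (hh : IntervalIntegrable h volume 0 t) :
    Real.exp (-(l * t)) • a + ∫ s in (0 : ℝ)..t, Real.exp (-(l * (t - s))) • h s =
      a + ∫ s in (0 : ℝ)..t, (h s - l • (Real.exp (-(l * s)) • a +
        ∫ r in (0 : ℝ)..s, Real.exp (-(l * (s - r))) • h r)) := by
  have h1 : IntervalIntegrable (fun s => l • (Real.exp (-(l * s)) • a)) volume 0 t :=
    Continuous.intervalIntegrable (by fun_prop) _ _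
  have h2 : IntervalIntegrable
      (fun s => l • ∫ r in (0 : ℝ)..s, Real.exp (-(l * (s - r))) • h r) volume 0 t :=
    ((continuousOn_integral_exp_smul l hh).const_smul l).intervalIntegrable
  simp only [smul_add]
  rw [intervalIntegral.integral_sub hh (h1.add h2), intervalIntegral.integral_add h1 h2,
    integral_smul_integral_exp_smul l ht hh]
  simp only [sub_smul, one_smul]
  rw [intervalIntegral.integral_sub hh (intervalIntegrable_exp_smul l t hh)]
  simp only [smul_smul]
  rw [intervalIntegral.integral_smul_const, integral_exp_mul_neg, sub_smul, one_smul]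
  abel

/-- Uniqueness for `d' + l d = 0`, `d 0 = 0`, in integrated form. -/
theorem eq_zero_of_eq_integral_smul (l : ℝ) {d : ℝ → E} {T : ℝ}
    (hd : ContinuousOn d (Icc 0 T))
    (h : ∀ t ∈ Icc 0 T, d t = ∫ s in (0 : ℝ)..t, -(l • d s)) : ∀ t ∈ Icc 0 T, d t = 0 := by
  intro t ht
  have h0T : 0 ≤ T := ht.1.trans ht.2
  have hc : Continuous (IccExtend h0T ((Icc 0 T).domRestrict d)) :=
    (continuousOn_iff_continuous_domRestrict.mp hd).Icc_extend'
  set e := IccExtend h0T ((Icc 0 T).domRestrict d) with he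
  have hed : ∀ s ∈ Icc 0 T, e s = d s := fun s hs => by rw [he, IccExtend_of_mem _ _ hs]; rfl
  have hde : ∀ s ∈ Icc 0 T, d s = ∫ r in (0 : ℝ)..s, -(l • e r) := fun s hs => by
    rw [h s hs]
    refine intervalIntegral.integral_congr fun r hr => ?_
    rw [uIcc_of_le hs.1] at hr
    simp only [hed r ⟨hr.1, hr.2.trans hs.2⟩]
  have hder : ∀ s, HasDerivAt (fun s => ∫ r in (0 : ℝ)..s, -(l • e r)) (-(l • e s)) s :=
    fun s => (by fun_prop : Continuous fun r => -(l • e r)).integral_hasStrictDerivAt 0 s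
      |>.hasDerivAt
  have := norm_le_gronwallBound_of_norm_deriv_right_le (δ := 0) (K := |l|) (ε := 0)
    (f := fun s => ∫ r in (0 : ℝ)..s, -(l • e r)) (a := 0) (b := T)
    (fun s _ => (hder s).continuousAt.continuousWithinAt)
    (fun s _ => (hder s).hasDerivWithinAt) (by simp)
    (fun s hs => by
      rw [← hde s (Ico_subset_Icc_self hs), hed s (Ico_subset_Icc_self hs), norm_neg, norm_smul,
        Real.norm_eq_abs, add_zero]) t ht
  rw [← hde t ht, gronwallBound_ε0_δ0] at this
  exact norm_le_zero_iff.mp this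

end ScalarEquation

/-! ### Mild solutions -/

section MildSolution

variable {ι 𝕜 H : Type*} [RCLike 𝕜] [NormedAddCommGroup H] [InnerProductSpace 𝕜 H]
  (b : HilbertBasis ι 𝕜 H) {lam : ι → ℝ}
  (hlam : ∀ i, 0 ≤ lam i) {g : ℝ → H} {T : ℝ}

theorem aestronglyMeasurable_heatOp {μ : Measure ℝ} (hg : AEStronglyMeasurable g μ) (t : ℝ) :
    AEStronglyMeasurable (fun s => heatOp b hlam (t - s) (g s)) μ := by
  have h1 : Continuous fun s : ℝ => t - s := by fun_prop
  have h2 : AEStronglyMeasurable (fun s => (g s, t - s)) μ := hg.prodMk h1.aestronglyMeasurable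
  have h3 := (continuous_heatOp_uncurry b hlam).comp_aestronglyMeasurable h2
  exact h3

theorem intervalIntegrable_heatOp {a c : ℝ} (hg : IntervalIntegrable g volume a c) (t : ℝ) :
    IntervalIntegrable (fun s => heatOp b hlam (t - s) (g s)) volume a c := by
  refine hg.mono_fun (aestronglyMeasurable_heatOp b hlam (intervalIntegrable_iff.mp hg).aestronglyMeasurable t) ?_
  filter_upwards with s
  exact norm_heatOp_le b hlam _ _

/-- To test a weak identity against all `φ` in the domain of `A`, it suffices to test it against the
eigenbasis. -/
theorem inner_eq_of_forall_basis {A : H →ₗ.[𝕜] H} (hA : A.IsFormalAdjoint A)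
    (hb : ∀ i, ∃ h : b i ∈ A.domain, A ⟨b i, h⟩ = (lam i : 𝕜) • b i) {v w : H}
    (h : ∀ i, inner 𝕜 (b i) v = lam i * inner 𝕜 (b i) w) (φ : A.domain) :
    inner 𝕜 (φ : H) v = inner 𝕜 (A φ) w := by
  rw [← b.tsum_inner_mul_inner, ← b.tsum_inner_mul_inner]
  refine tsum_congr fun i => ?_
  obtain ⟨hi, hi'⟩ := hb i
  have h1 := hA φ ⟨b i, hi⟩
  rw [hi'] at h1
  rw [h1, h, inner_smul_right]
  ring

variable [NormedSpace ℝ H]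

/-- The mild solution of `y' + A y = g`, `y 0 = y₀`, given by the Duhamel formula. -/
noncomputable def mildSolution (g : ℝ → H) (y₀ : H) (t : ℝ) : H :=
  heatOp b hlam t y₀ + ∫ s in (0 : ℝ)..t, heatOp b hlam (t - s) (g s)

theorem mildSolution_add {f : ℝ → H} (hg : IntervalIntegrable g volume 0 T)
    (hf : IntervalIntegrable f volume 0 T) (y₀ : H) :
    mildSolution b hlam (fun t => g t + f t) y₀ T =
      mildSolution b hlam g 0 T + mildSolution b hlam f y₀ T := by
  simp only [mildSolution, map_add, map_zero, zero_add]
  rw [intervalIntegral.integral_add (intervalIntegrable_heatOp b hlam hg T)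
    (intervalIntegrable_heatOp b hlam hf T)]
  abel

theorem continuousOn_mildSolution (hT : 0 ≤ T) (hg : IntervalIntegrable g volume 0 T) (y₀ : H) :
    ContinuousOn (mildSolution b hlam g y₀) (Icc 0 T) := by
  -- The semigroup is the identity at negative times, so the upper limit can be moved to `T`.
  have h1 : ∀ t ∈ Icc 0 T, mildSolution b hlam g y₀ t = heatOp b hlam t y₀ +
      ((∫ s in (0 : ℝ)..T, heatOp b hlam (t - s) (g s)) - ∫ s in t..T, g s) := fun t ht => by
    have hgt : IntervalIntegrable g volume 0 t :=
      hg.mono_set (by rw [uIcc_of_le ht.1, uIcc_of_le hT]; exact Icc_subset_Icc_right ht.2)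
    have hgt' : IntervalIntegrable g volume t T :=
      hg.mono_set (by rw [uIcc_of_le ht.2, uIcc_of_le hT]; exact Icc_subset_Icc_left ht.1)
    rw [mildSolution, ← intervalIntegral.integral_add_adjacent_intervals
      (intervalIntegrable_heatOp b hlam hgt t) (intervalIntegrable_heatOp b hlam hgt' t)]
    have h2 : ∫ s in t..T, heatOp b hlam (t - s) (g s) = ∫ s in t..T, g s := by
      refine intervalIntegral.integral_congr fun s hs => ?_
      rw [uIcc_of_le ht.2] at hs
      have h3 : heatOp b hlam (t - s) = heatOp b hlam 0 := by
        simp only [heatOp, max_eq_right (sub_nonpos.mpr hs.1), max_self]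
      simp only [h3, heatOp_zero]
    rw [h2, add_sub_cancel_right]
  refine ContinuousOn.congr ?_ h1
  refine (continuous_heatOp b hlam y₀).continuousOn.add (ContinuousOn.sub ?_ ?_)
  · refine Continuous.continuousOn ?_
    refine intervalIntegral.continuous_of_dominated_interval (bound := fun s => ‖g s‖)
      (fun t => aestronglyMeasurable_heatOp b hlam (intervalIntegrable_iff.mp hg).aestronglyMeasurable t)
      (fun t => ?_) hg.norm ?_
    · filter_upwards with s _
      exact norm_heatOp_le b hlam _ _
    · filter_upwards with s _
      exact (continuous_heatOp b hlam (g s)).comp (by fun_prop)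
  · rw [← uIcc_of_le hT]
    refine intervalIntegral.continuousOn_primitive_interval_left ?_
    rw [uIcc_of_le hT, integrableOn_Icc_iff_integrableOn_Ioc]
    exact (intervalIntegrable_iff_integrableOn_Ioc_of_le hT).mp hg

variable [CompleteSpace H] [IsScalarTower ℝ 𝕜 H]

theorem inner_intervalIntegral {h : ℝ → H} {a c : ℝ} (hh : IntervalIntegrable h volume a c)
    (x : H) : inner 𝕜 x (∫ s in a..c, h s) = ∫ s in a..c, inner 𝕜 x (h s) :=
  (((innerSL 𝕜 x).restrictScalars ℝ).intervalIntegral_comp_comm hh).symm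

theorem inner_mildSolution (hT : 0 ≤ T) (hg : IntervalIntegrable g volume 0 T) (y₀ : H) (i : ι) :
    inner 𝕜 (b i) (mildSolution b hlam g y₀ T) =
      Real.exp (-(lam i * T)) • inner 𝕜 (b i) y₀ +
        ∫ s in (0 : ℝ)..T, Real.exp (-(lam i * (T - s))) • inner 𝕜 (b i) (g s) := by
  rw [mildSolution, inner_add_right, inner_heatOp b hlam hT,
    inner_intervalIntegral (intervalIntegrable_heatOp b hlam hg T), RCLike.real_smul_eq_coe_mul]
  congr 1
  refine intervalIntegral.integral_congr fun s hs => ?_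
  rw [uIcc_of_le hT] at hs
  simp only [inner_heatOp b hlam (sub_nonneg.mpr hs.2), RCLike.real_smul_eq_coe_mul]

end MildSolution

section Solutions

open SwitchingControl

variable {ι 𝕜 H : Type*} [RCLike 𝕜] [NormedAddCommGroup H] [InnerProductSpace 𝕜 H]
  [CompleteSpace H] {b : HilbertBasis ι 𝕜 H} {lam : ι → ℝ} {A : H →ₗ.[𝕜] H} {g : ℝ → H} {T : ℝ}

/-- For self-adjoint `A`, testing against the domain of the adjoint is testing against the domain of
`A`. -/
theorem forall_adjoint_domain_iff (hsa : A.adjoint = A)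
    (P : H → H → Prop) :
    (∀ φ : A.adjoint.domain, P φ (A.adjoint φ)) ↔ ∀ φ : A.domain, P φ (A φ) := by
  rw [hsa]

theorem isSolution_unique (hsa : A.adjoint = A)
    (hb : ∀ i, ∃ h : b i ∈ A.domain, A ⟨b i, h⟩ = (lam i : 𝕜) • b i)
    {y₀ : H} {y y' : ℝ → H} (hT : 0 ≤ T)
    (hg : IntervalIntegrable g volume 0 T)
    (hy : IsSolution A T g y₀ y) (hy' : IsSolution A T g y₀ y') : ∀ t ∈ Icc 0 T, y t = y' t := by
  intro t ht
  refine b.ext_inner fun i => sub_eq_zero.mp ?_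
  have hc : ∀ {z : ℝ → H}, IsSolution A T g y₀ z →
      ContinuousOn (fun s => inner 𝕜 (b i) (z s)) (Icc 0 T) := fun hz =>
    (innerSL 𝕜 (b i)).continuous.comp_continuousOn hz.continuousOn
  have hw : ∀ {z : ℝ → H}, IsSolution A T g y₀ z → ∀ t ∈ Icc 0 T,
      inner 𝕜 (b i) (z t) = inner 𝕜 (b i) y₀ +
        ∫ s in (0 : ℝ)..t, (inner 𝕜 (b i) (g s) - (lam i : 𝕜) * inner 𝕜 (b i) (z s)) := by
    intro z hz
    have h1 := (forall_adjoint_domain_iff hsa (fun φ ψ => ∀ t ∈ Icc 0 T,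
      inner 𝕜 φ (z t) = inner 𝕜 φ y₀ +
        ∫ s in (0 : ℝ)..t, (inner 𝕜 φ (g s) - inner 𝕜 ψ (z s)))).mp hz.weak
    obtain ⟨hi, hi'⟩ := hb i
    have h2 := h1 ⟨b i, hi⟩
    simpa only [hi', inner_smul_left, RCLike.conj_ofReal] using h2
  refine eq_zero_of_eq_integral_smul (lam i)
    (d := fun t => inner 𝕜 (b i) (y t) - inner 𝕜 (b i) (y' t)) ((hc hy).sub (hc hy'))
    (fun t ht => ?_) t ht
  have hsub : uIcc 0 t ⊆ Icc 0 T := by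
    rw [uIcc_of_le ht.1]; exact Icc_subset_Icc_right ht.2
  have hgi : IntervalIntegrable (fun s => inner 𝕜 (b i) (g s)) volume 0 t :=
    have hgt : IntervalIntegrable g volume 0 t := hg.mono_set (by rwa [uIcc_of_le hT])
    ⟨(innerSL 𝕜 (b i)).integrable_comp hgt.1, (innerSL 𝕜 (b i)).integrable_comp hgt.2⟩
  have hyi : ∀ {z : ℝ → H}, IsSolution A T g y₀ z →
      IntervalIntegrable (fun s => (lam i : 𝕜) * inner 𝕜 (b i) (z s)) volume 0 t := fun hz =>
    (((hc hz).mono hsub).intervalIntegrable).const_mul _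
  rw [hw hy t ht, hw hy' t ht, add_sub_add_left_eq_sub,
    ← intervalIntegral.integral_sub (hgi.sub (hyi hy)) (hgi.sub (hyi hy'))]
  refine intervalIntegral.integral_congr fun s _ => ?_
  simp only [RCLike.real_smul_eq_coe_mul]
  ring

variable [NormedSpace ℝ H] [IsScalarTower ℝ 𝕜 H]

/-- The mild solution is a weak solution: on the eigenbasis this is the scalar Duhamel formula. -/
theorem isSolution_mildSolution (hsa : A.adjoint = A) (hA : A.IsFormalAdjoint A)
    (hb : ∀ i, ∃ h : b i ∈ A.domain, A ⟨b i, h⟩ = (lam i : 𝕜) • b i)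
    (hlam : ∀ i, 0 ≤ lam i) (hT : 0 ≤ T)
    (hg : IntervalIntegrable g volume 0 T) (y₀ : H) :
    IsSolution A T g y₀ (mildSolution b hlam g y₀) := by
  have hcont := continuousOn_mildSolution b hlam hT hg y₀
  refine ⟨hcont, by simp [mildSolution, heatOp_zero], ?_⟩
  rw [forall_adjoint_domain_iff hsa (fun φ ψ => ∀ t ∈ Icc 0 T,
    inner 𝕜 φ (mildSolution b hlam g y₀ t) = inner 𝕜 φ y₀ +
      ∫ s in (0 : ℝ)..t, (inner 𝕜 φ (g s) - inner 𝕜 ψ (mildSolution b hlam g y₀ s)))]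
  intro φ t ht
  have hgt : IntervalIntegrable g volume 0 t :=
    hg.mono_set (by rw [uIcc_of_le ht.1, uIcc_of_le hT]; exact Icc_subset_Icc_right ht.2)
  have hyt : IntervalIntegrable (mildSolution b hlam g y₀) volume 0 t :=
    (hcont.mono (by rw [uIcc_of_le ht.1]; exact Icc_subset_Icc_right ht.2)).intervalIntegrable
  have hin : ∀ {h : ℝ → H} (x : H), IntervalIntegrable h volume 0 t →
      IntervalIntegrable (fun s => inner 𝕜 x (h s)) volume 0 t := fun x hh =>
    ⟨((innerSL 𝕜 x).restrictScalars ℝ).integrable_comp hh.1,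
      ((innerSL 𝕜 x).restrictScalars ℝ).integrable_comp hh.2⟩
  have key := inner_eq_of_forall_basis b hA hb
    (v := (y₀ + ∫ s in (0 : ℝ)..t, g s) - mildSolution b hlam g y₀ t)
    (w := ∫ s in (0 : ℝ)..t, mildSolution b hlam g y₀ s) (fun i => ?_) φ
  · rw [inner_sub_right, inner_add_right, inner_intervalIntegral hgt,
      inner_intervalIntegral hyt] at key
    rw [intervalIntegral.integral_sub (hin _ hgt) (hin _ hyt), ← key]
    ring
  · rw [inner_sub_right, inner_add_right, inner_intervalIntegral hgt,
      inner_intervalIntegral hyt, inner_mildSolution b hlam ht.1 hgt,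
      duhamel_integral_eq _ _ ht.1 (hin (b i) hgt)]
    have h1 : ∫ s in (0 : ℝ)..t, (inner 𝕜 (b i) (g s) - lam i • (Real.exp (-(lam i * s)) •
        inner 𝕜 (b i) y₀ + ∫ r in (0 : ℝ)..s, Real.exp (-(lam i * (s - r))) •
          inner 𝕜 (b i) (g r))) =
        ∫ s in (0 : ℝ)..t, (inner 𝕜 (b i) (g s) -
          lam i • inner 𝕜 (b i) (mildSolution b hlam g y₀ s)) := by
      refine intervalIntegral.integral_congr fun s hs => ?_
      rw [uIcc_of_le ht.1] at hs
      have hgs : IntervalIntegrable g volume 0 s := hgt.mono_set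
        (by rw [uIcc_of_le ht.1, uIcc_of_le hs.1]; exact Icc_subset_Icc_right hs.2)
      simp only [inner_mildSolution b hlam hs.1 hgs]
    have h2 : IntervalIntegrable (fun s => lam i • inner 𝕜 (b i) (mildSolution b hlam g y₀ s))
        volume 0 t := by
      simpa only [RCLike.real_smul_eq_coe_mul] using (hin (b i) hyt).const_mul (lam i : 𝕜)
    rw [h1, intervalIntegral.integral_sub (hin _ hgt) h2,
      intervalIntegral.integral_smul, RCLike.real_smul_eq_coe_mul]
    ring

/-- Being driven to zero, expressed through the Duhamel formula. -/
theorem drivesToZero_iff (hsa : A.adjoint = A) (hA : A.IsFormalAdjoint A)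
    (hb : ∀ i, ∃ h : b i ∈ A.domain, A ⟨b i, h⟩ = (lam i : 𝕜) • b i)
    (hlam : ∀ i, 0 ≤ lam i) (hT : 0 ≤ T)
    (hg : IntervalIntegrable g volume 0 T) (y₀ : H) :
    DrivesToZero A T g y₀ ↔ mildSolution b hlam g y₀ T = 0 := by
  have h := isSolution_mildSolution hsa hA hb hlam hT hg y₀
  refine ⟨fun h' => h'.2 _ h, fun h' => ⟨⟨_, h⟩, fun y hy => ?_⟩⟩
  rw [isSolution_unique hsa hb hT hg hy h T ⟨hT, le_rfl⟩, h']

/-- The adjoint equation is the time reversal of the homogeneous equation, `A` being self-adjoint. -/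
theorem isAdjointSolution_heatOp (hsa : A.adjoint = A) (hA : A.IsFormalAdjoint A)
    (hb : ∀ i, ∃ h : b i ∈ A.domain, A ⟨b i, h⟩ = (lam i : 𝕜) • b i)
    (hlam : ∀ i, 0 ≤ lam i) (z : H) :
    IsAdjointSolution A T z (fun t => heatOp b hlam (T - t) z) := by
  refine ⟨((continuous_heatOp b hlam z).comp (by fun_prop)).continuousOn,
    by simp [heatOp_zero], fun φ t ht => ?_⟩
  have hTt : 0 ≤ T - t := sub_nonneg.mpr ht.2
  have h1 := (forall_adjoint_domain_iff hsa (fun φ ψ => ∀ r ∈ Icc 0 (T - t),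
    inner 𝕜 φ (mildSolution b hlam (fun _ => 0) z r) = inner 𝕜 φ z +
      ∫ s in (0 : ℝ)..r, (inner 𝕜 φ (0 : H) -
        inner 𝕜 ψ (mildSolution b hlam (fun _ => 0) z s)))).mp
    (isSolution_mildSolution hsa hA hb hlam hTt (g := fun _ => 0) (by simp) z).weak
    φ (T - t) ⟨hTt, le_rfl⟩
  simp only [mildSolution, map_zero, intervalIntegral.integral_zero, add_zero, inner_zero_right,
    zero_sub, intervalIntegral.integral_neg] at h1
  rw [h1, ← sub_eq_add_neg]
  congr 1
  have h2 := intervalIntegral.integral_comp_sub_left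
    (fun s => inner 𝕜 (A φ) (heatOp b hlam s z)) T (a := t) (b := T)
  rw [h2, sub_self]

end Solutions

/-! ### Convex minimization and dual extension -/

/-- A linear form bounded by `C ‖Φ z‖` factors through a continuous linear form on the target. -/
theorem exists_dual_of_le_norm {V F : Type*} [AddCommGroup V] [Module ℝ V]
    [NormedAddCommGroup F] [NormedSpace ℝ F] (Φ : V →ₗ[ℝ] F)
    (l : V →ₗ[ℝ] ℝ) {C : ℝ} (h : ∀ z, |l z| ≤ C * ‖Φ z‖) :
    ∃ L : F →L[ℝ] ℝ, ∀ z, L (Φ z) = l z := by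
  have hker : ∀ z z', Φ z = Φ z' → l z = l z' := fun z z' hz => by
    have := h (z - z')
    rw [map_sub, map_sub, hz, sub_self, norm_zero, mul_zero] at this
    simpa [sub_eq_zero] using abs_nonpos_iff.mp this
  choose s hs using fun x : LinearMap.range Φ => x.2
  let l' : LinearMap.range Φ →ₗ[ℝ] ℝ :=
    { toFun := fun x => l (s x)
      map_add' := fun x y => by
        rw [← map_add]; exact hker _ _ (by simp [hs])
      map_smul' := fun a x => by
        rw [RingHom.id_apply, ← map_smul]; exact hker _ _ (by simp [hs]) }
  obtain ⟨L, hL, -⟩ := exists_extension_norm_eq (LinearMap.range Φ)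
    (l'.mkContinuous C fun x => by
      have := h (s x)
      rw [hs] at this
      exact this)
  refine ⟨L, fun z => ?_⟩
  have h1 := hL ⟨Φ z, z, rfl⟩
  exact h1.trans (hker _ _ (hs _))

section Minimization

open Filter Topology

variable {E : Type*} [NormedAddCommGroup E] [InnerProductSpace ℝ E] [CompleteSpace E]

/-- In a Hilbert space, a decreasing sequence of nonempty bounded closed convex sets has a common
point: the elements of minimal norm form a Cauchy sequence, by the parallelogram law. -/
theorem nonempty_iInter_of_closed_convex {C : ℕ → Set E} (hanti : Antitone C)
    (hne : ∀ n, (C n).Nonempty) (hcl : ∀ n, IsClosed (C n)) (hconv : ∀ n, Convex ℝ (C n))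
    {r : ℝ} (hr : ∀ x ∈ C 0, ‖x‖ ≤ r) : (⋂ n, C n).Nonempty := by
  choose p hp hpmin using fun n =>
    exists_norm_eq_iInf_of_complete_convex (hne n) (hcl n).isComplete (hconv n) (0 : E)
  have hle : ∀ n, ∀ x ∈ C n, ‖p n‖ ≤ ‖x‖ := fun n x hx => by
    have h1 := hpmin n
    simp only [zero_sub, norm_neg] at h1
    rw [h1]
    exact ciInf_le (f := fun w : C n => ‖(w : E)‖)
      ⟨0, by rintro _ ⟨w, rfl⟩; exact norm_nonneg _⟩ ⟨x, hx⟩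
  have hmono : Monotone fun n => ‖p n‖ ^ 2 := fun n k hnk =>
    pow_le_pow_left₀ (norm_nonneg _) (hle n _ (hanti hnk (hp k))) 2
  have hbdd : BddAbove (range fun n => ‖p n‖ ^ 2) := by
    refine ⟨r ^ 2, ?_⟩
    rintro _ ⟨n, rfl⟩
    exact pow_le_pow_left₀ (norm_nonneg _) (hr _ (hanti (Nat.zero_le n) (hp n))) 2
  have hcauchy : CauchySeq fun n => ‖p n‖ ^ 2 :=
    (tendsto_atTop_ciSup hmono hbdd).cauchySeq
  have hpar : ∀ n k, n ≤ k → ‖p n - p k‖ ^ 2 ≤ 2 * (‖p k‖ ^ 2 - ‖p n‖ ^ 2) := fun n k hnk => by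
    have h1 := hle n _ (hconv n (hp n) (hanti hnk (hp k)) (by norm_num : (0 : ℝ) ≤ 1 / 2)
      (by norm_num : (0 : ℝ) ≤ 1 / 2) (by norm_num))
    rw [← smul_add, norm_smul, Real.norm_of_nonneg (by norm_num)] at h1
    have h2 := parallelogram_law_with_norm ℝ (p n) (p k)
    nlinarith [norm_nonneg (p n), norm_nonneg (p n + p k)]
  have hpc : CauchySeq p := by
    rw [Metric.cauchySeq_iff'] at hcauchy ⊢
    intro ε hε
    obtain ⟨N, hN⟩ := hcauchy (ε ^ 2 / 2) (by positivity)
    refine ⟨N, fun n hn => ?_⟩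
    have h1 := hpar N n hn
    have h2 := (le_abs_self _).trans_lt (hN n hn)
    rw [dist_comm, dist_eq_norm]
    exact lt_of_pow_lt_pow_left₀ 2 hε.le (by linarith)
  obtain ⟨x, hx⟩ := cauchySeq_tendsto_of_complete hpc
  refine ⟨x, mem_iInter.mpr fun n => (hcl n).mem_of_tendsto hx ?_⟩
  filter_upwards [eventually_ge_atTop n] with k hk
  exact hanti hk (hp k)

/-- A continuous convex function that is coercive attains its minimum on a closed subspace of a
Hilbert space. -/
theorem exists_minimizer_of_convex_coercive (K : Submodule ℝ E) (hK : IsClosed (K : Set E))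
    {F : E → ℝ} (hF : Continuous F) (hconv : ConvexOn ℝ univ F) {c d : ℝ} (hc : 0 < c)
    (hcoer : ∀ x ∈ K, c * ‖x‖ ^ 2 - d * ‖x‖ ≤ F x) : ∃ w ∈ K, ∀ v ∈ K, F w ≤ F v := by
  have hbound : ∀ a, ∃ r, ∀ x ∈ K, F x ≤ a → ‖x‖ ≤ r := fun a => by
    refine ⟨(|d| + |a|) / c + 1, fun x hx hxa => ?_⟩
    have h1 := hcoer x hx
    by_contra! h
    have h2 : (|d| + |a|) < c * (‖x‖ - 1) := by
      have := (div_lt_iff₀ hc).mp (show (|d| + |a|) / c < ‖x‖ - 1 by linarith)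
      linarith
    have h3 : 1 < ‖x‖ := by
      have : 0 ≤ (|d| + |a|) / c := by positivity
      linarith
    nlinarith [le_abs_self d, le_abs_self a, abs_nonneg a, abs_nonneg d]
  have hbelow : BddBelow (F '' K) := by
    refine ⟨-(d ^ 2 / (4 * c)), ?_⟩
    rintro _ ⟨x, hx, rfl⟩
    refine le_trans ?_ (hcoer x hx)
    have : d ^ 2 / (4 * c) * (4 * c) = d ^ 2 := by field_simp
    nlinarith [sq_nonneg (2 * c * ‖x‖ - d)]
  set m := sInf (F '' K) with hm
  have hne : (F '' K).Nonempty := ⟨F 0, 0, K.zero_mem, rfl⟩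
  -- The minimizers form the intersection of the sublevel sets `F ≤ m + 1 / (n + 1)`.
  set C : ℕ → Set E := fun n => K ∩ {x | F x ≤ m + 1 / (n + 1)} with hC
  have hanti : Antitone C := fun n k hnk x hx => by
    refine ⟨hx.1, le_trans (show F x ≤ _ from hx.2) ?_⟩
    gcongr
  obtain ⟨r, hr⟩ := hbound (m + 1 / ((0 : ℕ) + 1))
  obtain ⟨w, hw⟩ := nonempty_iInter_of_closed_convex hanti
    (fun n => by
      have hpos : (0 : ℝ) < 1 / (n + 1) := Nat.one_div_pos_of_nat
      obtain ⟨_, ⟨x, hx, rfl⟩, hlt⟩ := exists_lt_of_csInf_lt hne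
        (show sInf (F '' K) < m + 1 / (n + 1) by linarith)
      exact ⟨x, hx, hlt.le⟩)
    (fun n => hK.inter (isClosed_le hF continuous_const))
    (fun n => K.convex.inter (by simpa using hconv.convex_le (m + 1 / ((n : ℝ) + 1))))
    (r := r) (fun x hx => hr x hx.1 hx.2)
  rw [mem_iInter] at hw
  refine ⟨w, (hw 0).1, fun v hv => ?_⟩
  have h1 : F w ≤ m := by
    refine ge_of_tendsto' (x := atTop) (f := fun n : ℕ => m + 1 / ((n : ℝ) + 1)) ?_
      fun n => (hw n).2
    simpa using tendsto_const_nhds.add (tendsto_one_div_add_atTop_nhds_zero_nat (𝕜 := ℝ))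
  exact h1.trans (csInf_le hbelow ⟨v, hv, rfl⟩)

end Minimization

section SwitchingDensity

variable {G₁ G₂ : Type*} [NormedAddCommGroup G₁] [InnerProductSpace ℝ G₁]
  [NormedAddCommGroup G₂] [InnerProductSpace ℝ G₂]

theorem hasDerivAt_norm_sq_add_smul {G : Type*} [NormedAddCommGroup G] [InnerProductSpace ℝ G]
    (p q : G) : HasDerivAt (fun ε : ℝ => ‖p + ε • q‖ ^ 2) (2 * inner ℝ p q) 0 := by
  have h1 : HasDerivAt (fun ε : ℝ => p + ε • q) q 0 := by
    simpa using ((hasDerivAt_id (0 : ℝ)).smul_const q).const_add p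
  simpa using h1.norm_sq

/-- The maximum of two quadratics is differentiable where they differ, and where both vanish. -/
theorem hasDerivAt_max_norm_sq {η : ℝ} {p₁ q₁ : G₁} {p₂ q₂ : G₂}
    (h : ‖p₁‖ ^ 2 ≠ η * ‖p₂‖ ^ 2 ∨ (p₁ = 0 ∧ p₂ = 0)) :
    HasDerivAt (fun ε : ℝ => max (‖p₁ + ε • q₁‖ ^ 2) (η * ‖p₂ + ε • q₂‖ ^ 2))
      (2 * (inner ℝ (if η * ‖p₂‖ ^ 2 < ‖p₁‖ ^ 2 then p₁ else 0) q₁ +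
        inner ℝ (if ‖p₁‖ ^ 2 < η * ‖p₂‖ ^ 2 then η • p₂ else 0) q₂)) 0 := by
  have h1 := hasDerivAt_norm_sq_add_smul p₁ q₁
  have h2 := (hasDerivAt_norm_sq_add_smul p₂ q₂).const_mul η
  have c1 : ContinuousAt (fun ε : ℝ => ‖p₁ + ε • q₁‖ ^ 2) 0 := h1.continuousAt
  have c2 : ContinuousAt (fun ε : ℝ => η * ‖p₂ + ε • q₂‖ ^ 2) 0 := h2.continuousAt
  rcases lt_trichotomy (‖p₁‖ ^ 2) (η * ‖p₂‖ ^ 2) with hlt | heq | hlt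
  · have hev := c1.eventually_lt c2 (by simpa using hlt)
    rw [if_neg hlt.not_gt, if_pos hlt, inner_zero_left, zero_add, inner_smul_left]
    refine (h2.congr_of_eventuallyEq (hev.mono fun ε hε => max_eq_right hε.le)).congr_deriv ?_
    simp only [conj_trivial]
    ring
  · obtain ⟨rfl, rfl⟩ := h.resolve_left (not_not.mpr heq)
    have h3 : ∀ ε : ℝ, max (‖(0 : G₁) + ε • q₁‖ ^ 2) (η * ‖(0 : G₂) + ε • q₂‖ ^ 2) =
        ε ^ 2 * max (‖q₁‖ ^ 2) (η * ‖q₂‖ ^ 2) := fun ε => by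
      rw [zero_add, zero_add, norm_smul, norm_smul, mul_pow, mul_pow, Real.norm_eq_abs, sq_abs,
        mul_left_comm, mul_max_of_nonneg _ _ (sq_nonneg ε)]
    simp only [h3]
    simpa using ((hasDerivAt_id (0 : ℝ)).pow 2).mul_const (max (‖q₁‖ ^ 2) (η * ‖q₂‖ ^ 2))
  · have hev := c2.eventually_lt c1 (by simpa using hlt)
    rw [if_pos hlt, if_neg hlt.not_gt, inner_zero_left, add_zero]
    exact h1.congr_of_eventuallyEq (hev.mono fun ε hε => max_eq_left hε.le)

theorem abs_norm_sq_add_smul_sub_le {G : Type*} [NormedAddCommGroup G] [InnerProductSpace ℝ G]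
    (p q : G) {ε δ : ℝ} (hε : |ε| ≤ 1) (hδ : |δ| ≤ 1) :
    |‖p + ε • q‖ ^ 2 - ‖p + δ • q‖ ^ 2| ≤ 2 * (‖p‖ + ‖q‖) * ‖q‖ * |ε - δ| := by
  have hb : ∀ {ε : ℝ}, |ε| ≤ 1 → ‖p + ε • q‖ ≤ ‖p‖ + ‖q‖ := fun hε => by
    refine (norm_add_le _ _).trans ?_
    rw [norm_smul, Real.norm_eq_abs]
    gcongr
    exact mul_le_of_le_one_left (norm_nonneg _) hε
  have h1 : |‖p + ε • q‖ - ‖p + δ • q‖| ≤ |ε - δ| * ‖q‖ := by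
    refine (abs_norm_sub_norm_le _ _).trans ?_
    rw [add_sub_add_left_eq_sub, ← sub_smul, norm_smul, Real.norm_eq_abs]
  rw [sq_sub_sq, abs_mul, abs_of_nonneg (by positivity)]
  calc _ ≤ ((‖p‖ + ‖q‖) + (‖p‖ + ‖q‖)) * (|ε - δ| * ‖q‖) := by
        gcongr
        · exact hb hε
        · exact hb hδ
    _ = _ := by ring

end SwitchingDensity

/-! ### The switching functional on `L²` -/

section SwitchingFunctional

theorem continuous_of_convexOn_of_le_norm_sq {E : Type*} [NormedAddCommGroup E] [NormedSpace ℝ E]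
    {f : E → ℝ} (hf : ConvexOn ℝ univ f) {c : ℝ} (h : ∀ x, f x ≤ c * ‖x‖ ^ 2) : Continuous f := by
  rw [← continuousOn_univ]
  have h1 : (∃ x₀ ∈ univ, (nhds x₀).IsBoundedUnder (· ≤ ·) f) ↔ ContinuousOn f univ :=
    (hf.continuousOn_tfae isOpen_univ univ_nonempty).out 3 1
  refine h1.mp ⟨0, mem_univ _, ?_⟩
  have hc : Continuous fun x : E => c * ‖x‖ ^ 2 := by fun_prop
  exact (hc.tendsto 0).isBoundedUnder_le.mono_le (Filter.Eventually.of_forall h)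

variable {α U U₁ U₂ : Type*} [MeasurableSpace α] {μ : Measure α}
  [NormedAddCommGroup U] [InnerProductSpace ℝ U]
  [NormedAddCommGroup U₁] [InnerProductSpace ℝ U₁]
  [NormedAddCommGroup U₂] [InnerProductSpace ℝ U₂]

/-- The density `max (‖P₁ x‖², η ‖P₂ x‖²)` of the functional whose minimizers yield switching
controls. -/
noncomputable def switchDensity (P₁ : U →L[ℝ] U₁) (P₂ : U →L[ℝ] U₂) (η : ℝ) (x : U) : ℝ :=
  max (‖P₁ x‖ ^ 2) (η * ‖P₂ x‖ ^ 2)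

variable {P₁ : U →L[ℝ] U₁} {P₂ : U →L[ℝ] U₂}

theorem convexOn_norm_sq_clm {G : Type*} [NormedAddCommGroup G] [NormedSpace ℝ G]
    (P : U →L[ℝ] G) : ConvexOn ℝ univ fun x => ‖P x‖ ^ 2 := by
  have h1 : ConvexOn ℝ univ fun x => ‖P x‖ :=
    convexOn_univ_norm.comp_linearMap (P : U →L[ℝ] G).toLinearMap
  exact h1.pow (fun _ _ => norm_nonneg _) 2

theorem convexOn_switchDensity {η : ℝ} (hη : 0 ≤ η) : ConvexOn ℝ univ (switchDensity P₁ P₂ η) := by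
  exact (convexOn_norm_sq_clm P₁).sup ((convexOn_norm_sq_clm P₂).smul hη)

theorem integrable_norm_sq_clm {G : Type*} [NormedAddCommGroup G] [NormedSpace ℝ G]
    (P : U →L[ℝ] G) {w : α → U} (hw : MemLp w 2 μ) : Integrable (fun t => ‖P (w t)‖ ^ 2) μ :=
  (P.comp_memLp' hw).norm.integrable_sq

variable {η : α → ℝ} {δ M : ℝ}

theorem integrable_mul_norm_sq_clm (hηm : Measurable η) (hδ : 0 ≤ δ)
    (hη : ∀ t, δ ≤ η t ∧ η t ≤ M)
    {G : Type*} [NormedAddCommGroup G] [NormedSpace ℝ G]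
    (P : U →L[ℝ] G) {w : α → U} (hw : MemLp w 2 μ) :
    Integrable (fun t => η t * ‖P (w t)‖ ^ 2) μ :=
  (integrable_norm_sq_clm P hw).bdd_mul (c := M) hηm.aestronglyMeasurable
    (Filter.Eventually.of_forall fun t => by
      rw [Real.norm_of_nonneg (hδ.trans (hη t).1)]; exact (hη t).2)

theorem integrable_switchDensity (hηm : Measurable η) (hδ : 0 ≤ δ)
    (hη : ∀ t, δ ≤ η t ∧ η t ≤ M)
    {w : α → U} (hw : MemLp w 2 μ) :
    Integrable (fun t => switchDensity P₁ P₂ (η t) (w t)) μ :=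
  (integrable_norm_sq_clm P₁ hw).sup (integrable_mul_norm_sq_clm hηm hδ hη P₂ hw)

/-- The integral of the switching density over a square-integrable function. -/
noncomputable def switchEnergy (P₁ : U →L[ℝ] U₁) (P₂ : U →L[ℝ] U₂) (η : α → ℝ)
    (w : Lp U 2 μ) : ℝ :=
  ∫ t, switchDensity P₁ P₂ (η t) (w t) ∂μ

theorem convexOn_switchEnergy (hηm : Measurable η) (hδ : 0 ≤ δ)
    (hη : ∀ t, δ ≤ η t ∧ η t ≤ M) :
    ConvexOn ℝ univ (switchEnergy P₁ P₂ η : Lp U 2 μ → ℝ) := by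
  refine ⟨convex_univ, fun w _ v _ a c ha hc hac => ?_⟩
  have hi := fun w : Lp U 2 μ => integrable_switchDensity (P₁ := P₁) (P₂ := P₂) hηm hδ hη (Lp.memLp w)
  rw [smul_eq_mul, smul_eq_mul, switchEnergy, switchEnergy, switchEnergy, ← integral_const_mul,
    ← integral_const_mul, ← integral_add ((hi w).const_mul a) ((hi v).const_mul c)]
  refine integral_mono_ae (hi _) (((hi w).const_mul a).add ((hi v).const_mul c)) ?_
  filter_upwards [Lp.coeFn_add (a • w) (c • v), Lp.coeFn_smul a w, Lp.coeFn_smul c v]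
    with t h1 h2 h3
  rw [h1, Pi.add_apply, h2, h3, Pi.smul_apply, Pi.smul_apply]
  exact (convexOn_switchDensity (hδ.trans (hη t).1)).2 (mem_univ _) (mem_univ _) ha hc hac

theorem Lp_two_norm_sq (w : Lp U 2 μ) : ‖w‖ ^ 2 = ∫ t, ‖w t‖ ^ 2 ∂μ := by
  rw [← real_inner_self_eq_norm_sq, L2.inner_def]
  simp only [real_inner_self_eq_norm_sq]

theorem switchEnergy_le (hηm : Measurable η) (hδ : 0 ≤ δ)
    (hη : ∀ t, δ ≤ η t ∧ η t ≤ M)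
    (w : Lp U 2 μ) :
    switchEnergy P₁ P₂ η w ≤ (‖P₁‖ ^ 2 + M * ‖P₂‖ ^ 2) * ‖w‖ ^ 2 := by
  rw [Lp_two_norm_sq, ← integral_const_mul]
  refine integral_mono_ae (integrable_switchDensity hηm hδ hη (Lp.memLp w))
    ((Lp.memLp w).norm.integrable_sq.const_mul _) (Filter.Eventually.of_forall fun t => ?_)
  have hM : 0 ≤ M := hδ.trans ((hη t).1.trans (hη t).2)
  have h1 : ‖P₁ (w t)‖ ^ 2 ≤ ‖P₁‖ ^ 2 * ‖w t‖ ^ 2 := by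
    rw [← mul_pow]; gcongr; exact P₁.le_opNorm _
  have h2 : η t * ‖P₂ (w t)‖ ^ 2 ≤ M * ‖P₂‖ ^ 2 * ‖w t‖ ^ 2 := by
    rw [mul_assoc, ← mul_pow]
    gcongr
    · exact (hη t).2
    · exact P₂.le_opNorm _
  refine max_le ?_ ?_
  · have : 0 ≤ M * ‖P₂‖ ^ 2 * ‖w t‖ ^ 2 := by positivity
    simp only [add_mul]
    linarith
  · have : 0 ≤ ‖P₁‖ ^ 2 * ‖w t‖ ^ 2 := by positivity
    simp only [add_mul]
    linarith

theorem continuous_switchEnergy (hηm : Measurable η) (hδ : 0 ≤ δ)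
    (hη : ∀ t, δ ≤ η t ∧ η t ≤ M) : Continuous (switchEnergy P₁ P₂ η : Lp U 2 μ → ℝ) := by
  exact continuous_of_convexOn_of_le_norm_sq (convexOn_switchEnergy hηm hδ hη)
    (switchEnergy_le hηm hδ hη)

theorem norm_sq_le_switchEnergy (hηm : Measurable η) (hδ : 0 ≤ δ)
    (hη : ∀ t, δ ≤ η t ∧ η t ≤ M)
    {c : ℝ}
    (hP : ∀ x, ‖x‖ ^ 2 ≤ c * max (‖P₁ x‖ ^ 2) (δ * ‖P₂ x‖ ^ 2)) (hc : 0 ≤ c) (w : Lp U 2 μ) :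
    ‖w‖ ^ 2 ≤ c * switchEnergy P₁ P₂ η w := by
  rw [Lp_two_norm_sq, switchEnergy, ← integral_const_mul]
  refine integral_mono (Lp.memLp w).norm.integrable_sq
    ((integrable_switchDensity hηm hδ hη (Lp.memLp w)).const_mul _) fun t => (hP _).trans ?_
  unfold switchDensity
  gcongr
  exact (hη t).1

theorem integrable_two_mul_norm_clm {G : Type*} [NormedAddCommGroup G] [NormedSpace ℝ G]
    (P : U →L[ℝ] G) {w v : α → U} (hw : MemLp w 2 μ) (hv : MemLp v 2 μ) :
    Integrable (fun t => 2 * (‖P (w t)‖ + ‖P (v t)‖) * ‖P (v t)‖) μ := by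
  have h1 := ((P.comp_memLp' hw).norm.add (P.comp_memLp' hv).norm).integrable_mul
    (P.comp_memLp' hv).norm
  refine (h1.const_mul 2).congr (Filter.Eventually.of_forall fun t => ?_)
  simp only [Pi.mul_apply, Pi.add_apply, mul_assoc, Function.comp_apply]

/-- The Gateaux derivative of the switching energy at a `w` without ties. -/
theorem hasDerivAt_switchEnergy (hηm : Measurable η) (hδ : 0 ≤ δ)
    (hη : ∀ t, δ ≤ η t ∧ η t ≤ M)
    (w v : Lp U 2 μ)
    (htie : ∀ᵐ t ∂μ, ‖P₁ (w t)‖ ^ 2 ≠ η t * ‖P₂ (w t)‖ ^ 2 ∨ (P₁ (w t) = 0 ∧ P₂ (w t) = 0))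
    {u₁ : α → U₁} {u₂ : α → U₂} (hu₁m : MemLp u₁ 2 μ) (hu₂m : MemLp u₂ 2 μ)
    (hu₁ : ∀ t, u₁ t = if η t * ‖P₂ (w t)‖ ^ 2 < ‖P₁ (w t)‖ ^ 2 then P₁ (w t) else 0)
    (hu₂ : ∀ t, u₂ t = if ‖P₁ (w t)‖ ^ 2 < η t * ‖P₂ (w t)‖ ^ 2 then η t • P₂ (w t) else 0) :
    HasDerivAt (fun ε : ℝ => switchEnergy P₁ P₂ η (w + ε • v))
      (2 * ∫ t, (inner ℝ (u₁ t) (P₁ (v t)) + inner ℝ (u₂ t) (P₂ (v t))) ∂μ) 0 := by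
  have hw := Lp.memLp w
  have hv := Lp.memLp v
  have hwv : ∀ ε : ℝ, MemLp (fun t => w t + ε • v t) 2 μ := fun ε => hw.add (hv.const_smul ε)
  have heq : ∀ ε : ℝ, switchEnergy P₁ P₂ η (w + ε • v) =
      ∫ t, switchDensity P₁ P₂ (η t) (w t + ε • v t) ∂μ := fun ε => by
    refine integral_congr_ae ?_
    filter_upwards [Lp.coeFn_add w (ε • v), Lp.coeFn_smul ε v] with t h1 h2
    rw [h1, Pi.add_apply, h2, Pi.smul_apply]
  simp only [heq]
  rw [← integral_const_mul]
  refine (hasDerivAt_integral_of_dominated_loc_of_lip (Metric.ball_mem_nhds (0 : ℝ) one_pos)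
    (bound := fun t => 2 * (‖P₁ (w t)‖ + ‖P₁ (v t)‖) * ‖P₁ (v t)‖ +
      M * (2 * (‖P₂ (w t)‖ + ‖P₂ (v t)‖) * ‖P₂ (v t)‖))
    (Filter.Eventually.of_forall fun ε =>
      (integrable_switchDensity hηm hδ hη (hwv ε)).aestronglyMeasurable)
    (integrable_switchDensity hηm hδ hη (hwv 0)) ?_ ?_
    ((integrable_two_mul_norm_clm P₁ hw hv).add ((integrable_two_mul_norm_clm P₂ hw hv).const_mul M)) ?_).2
  · have h1 := hu₁m.aestronglyMeasurable.inner (𝕜 := ℝ)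
      (P₁.comp_memLp' hv).aestronglyMeasurable
    have h2 := hu₂m.aestronglyMeasurable.inner (𝕜 := ℝ)
      (P₂.comp_memLp' hv).aestronglyMeasurable
    exact (h1.add h2).const_mul 2
  · refine Filter.Eventually.of_forall fun t => LipschitzOnWith.of_dist_le_mul fun ε hε δ' hδ' => ?_
    have hM : 0 ≤ M := hδ.trans ((hη t).1.trans (hη t).2)
    rw [mem_ball_zero_iff] at hε hδ'
    have e1 := abs_norm_sq_add_smul_sub_le (P₁ (w t)) (P₁ (v t)) hε.le hδ'.le
    have e2 := abs_norm_sq_add_smul_sub_le (P₂ (w t)) (P₂ (v t)) hε.le hδ'.le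
    set b₁ := 2 * (‖P₁ (w t)‖ + ‖P₁ (v t)‖) * ‖P₁ (v t)‖
    set b₂ := 2 * (‖P₂ (w t)‖ + ‖P₂ (v t)‖) * ‖P₂ (v t)‖
    have hb₁0 : 0 ≤ b₁ := by positivity
    have hb₂0 : 0 ≤ b₂ := by positivity
    have hc : ((Real.nnabs (b₁ + M * b₂) : ℝ≥0) : ℝ) = b₁ + M * b₂ := by
      rw [Real.coe_nnabs, abs_of_nonneg (by positivity)]
    rw [hc, Real.dist_eq, Real.dist_eq]
    simp only [switchDensity, map_add, map_smul]
    refine (abs_max_sub_max_le_max _ _ _ _).trans (max_le ?_ ?_)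
    · refine e1.trans ?_
      have : 0 ≤ M * b₂ * |ε - δ'| := by positivity
      rw [add_mul]
      linarith
    · rw [← mul_sub, abs_mul, abs_of_nonneg (hδ.trans (hη t).1)]
      have h3 : η t * |‖P₂ (w t) + ε • P₂ (v t)‖ ^ 2 - ‖P₂ (w t) + δ' • P₂ (v t)‖ ^ 2| ≤
          M * (b₂ * |ε - δ'|) := by
        gcongr
        exact (hη t).2
      have : 0 ≤ b₁ * |ε - δ'| := by positivity
      rw [add_mul, mul_assoc M]
      linarith
  · filter_upwards [htie] with t ht
    rw [hu₁, hu₂]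
    simp only [switchDensity, map_add, map_smul]
    exact hasDerivAt_max_norm_sq ht

/-- Duality for switching controls: minimizing the switching energy minus a linear form over a
closed subspace `K` of `L²` produces, through the Euler–Lagrange equation, a representation of the
linear form on `K` by a pair of controls of which at most one is active at each time, provided that
no element of `K` has ties on a set of positive measure. -/
theorem exists_switching_representation [CompleteSpace U]
    (hηm : Measurable η) (hδ : 0 ≤ δ)
    (hη : ∀ t, δ ≤ η t ∧ η t ≤ M)
    {c : ℝ} (hc : 0 < c)
    (hP : ∀ x, ‖x‖ ^ 2 ≤ c * max (‖P₁ x‖ ^ 2) (δ * ‖P₂ x‖ ^ 2))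
    (K : Submodule ℝ (Lp U 2 μ)) (hK : IsClosed (K : Set (Lp U 2 μ)))
    (htie : ∀ w ∈ K, ∀ᵐ t ∂μ,
      ‖P₁ (w t)‖ ^ 2 ≠ η t * ‖P₂ (w t)‖ ^ 2 ∨ (P₁ (w t) = 0 ∧ P₂ (w t) = 0))
    (L : Lp U 2 μ →L[ℝ] ℝ) :
    ∃ (u₁ : α → U₁) (u₂ : α → U₂), MemLp u₁ 2 μ ∧ MemLp u₂ 2 μ ∧ (∀ t, ‖u₁ t‖ * ‖u₂ t‖ = 0) ∧
      ∀ v ∈ K, ∫ t, (inner ℝ (u₁ t) (P₁ (v t)) + inner ℝ (u₂ t) (P₂ (v t))) ∂μ = L v := by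
  obtain ⟨w, hwK, hmin⟩ := exists_minimizer_of_convex_coercive K hK
    (F := fun w => switchEnergy P₁ P₂ η w - 2 * L w) (c := c⁻¹) (d := 2 * ‖L‖)
    ((continuous_switchEnergy hηm hδ hη).sub (by fun_prop))
    ((convexOn_switchEnergy hηm hδ hη).sub
      (((2 : ℝ) • (L : Lp U 2 μ →ₗ[ℝ] ℝ)).concaveOn convex_univ)) (inv_pos.mpr hc)
    (fun x _ => by
      have h1 := norm_sq_le_switchEnergy hηm hδ hη hP hc.le x
      have h2 : c⁻¹ * ‖x‖ ^ 2 ≤ switchEnergy P₁ P₂ η x := by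
        rwa [inv_mul_le_iff₀ hc]
      have h3 := (le_abs_self _).trans (L.le_opNorm x)
      linarith)
  have hw := Lp.memLp w
  have hw₁ := P₁.comp_memLp' hw
  have hw₂ := P₂.comp_memLp' hw
  have hm₁ : AEMeasurable (fun t => ‖P₁ (w t)‖ ^ 2) μ :=
    (integrable_norm_sq_clm P₁ hw).aestronglyMeasurable.aemeasurable
  have hm₂ : AEMeasurable (fun t => η t * ‖P₂ (w t)‖ ^ 2) μ :=
    (integrable_mul_norm_sq_clm hηm hδ hη P₂ hw).aestronglyMeasurable.aemeasurable
  have hS₁ : NullMeasurableSet {t | η t * ‖P₂ (w t)‖ ^ 2 < ‖P₁ (w t)‖ ^ 2} μ :=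
    nullMeasurableSet_lt hm₂ hm₁
  have hS₂ : NullMeasurableSet {t | ‖P₁ (w t)‖ ^ 2 < η t * ‖P₂ (w t)‖ ^ 2} μ :=
    nullMeasurableSet_lt hm₁ hm₂
  -- The derivative of the density at `w t`; at a tie both components vanish.
  set u₁ : α → U₁ := fun t => if η t * ‖P₂ (w t)‖ ^ 2 < ‖P₁ (w t)‖ ^ 2 then P₁ (w t) else 0
    with hu₁
  set u₂ : α → U₂ := fun t => if ‖P₁ (w t)‖ ^ 2 < η t * ‖P₂ (w t)‖ ^ 2 then η t • P₂ (w t) else 0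
    with hu₂
  have hu₁m : MemLp u₁ 2 μ := by
    refine hw₁.mono ?_ (Filter.Eventually.of_forall fun t => ?_)
    · exact hw₁.aestronglyMeasurable.indicator₀ hS₁
    · simp only [hu₁]
      split_ifs
      · exact le_rfl
      · simp
  have hu₂m : MemLp u₂ 2 μ := by
    refine (hw₂.const_smul M).mono ?_ (Filter.Eventually.of_forall fun t => ?_)
    · exact (hηm.aestronglyMeasurable.smul hw₂.aestronglyMeasurable).indicator₀ hS₂
    · simp only [hu₂]
      split_ifs
      · rw [Pi.smul_apply, norm_smul, norm_smul, Real.norm_eq_abs, Real.norm_eq_abs,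
          abs_of_nonneg (hδ.trans (hη t).1)]
        exact mul_le_mul_of_nonneg_right ((hη t).2.trans (le_abs_self M)) (norm_nonneg _)
      · simp
  refine ⟨u₁, u₂, hu₁m, hu₂m, fun t => ?_, fun v hv => ?_⟩
  · simp only [hu₁, hu₂]
    split_ifs with h1 h2
    · exact absurd h1 h2.not_gt
    all_goals simp
  · have hd := (hasDerivAt_switchEnergy hηm hδ hη w v (htie w hwK) hu₁m hu₂m
      (fun _ => rfl) (fun _ => rfl)).sub
        ((((hasDerivAt_id (0 : ℝ)).mul_const (L v)).const_add (L w)).const_mul 2)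
    have hloc : IsLocalMin (fun ε : ℝ => switchEnergy P₁ P₂ η (w + ε • v) -
        2 * (L w + ε * L v)) 0 := by
      refine Filter.Eventually.of_forall fun ε => ?_
      have h1 := hmin _ (K.add_mem hwK (K.smul_mem ε hv))
      simpa using h1
    have h0 := hloc.hasDerivAt_eq_zero hd
    linarith

end SwitchingFunctional

/-! ### The observation map and its closure -/

section Observation

open Filter Topology

variable {ι 𝕜 H U : Type*} [RCLike 𝕜] [NormedAddCommGroup H] [InnerProductSpace 𝕜 H]
  [NormedAddCommGroup U] [InnerProductSpace 𝕜 U]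
  (b : HilbertBasis ι 𝕜 H) {lam : ι → ℝ} (hlam : ∀ i, 0 ≤ lam i) (D : H →L[𝕜] U)

theorem memLp_observation (T : ℝ) (z : H) :
    MemLp (fun t => D (heatOp b hlam (T - t) z)) 2 (volume.restrict (Ioo 0 T)) := by
  have hc : Continuous fun t : ℝ => D (heatOp b hlam (T - t) z) :=
    D.continuous.comp ((continuous_heatOp b hlam z).comp (by fun_prop))
  refine MemLp.of_bound hc.aestronglyMeasurable (‖D‖ * ‖z‖) (Eventually.of_forall fun t => ?_)
  exact (D.le_opNorm _).trans (by gcongr; exact norm_heatOp_le b hlam _ _)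

theorem norm_integral_inner_le {α : Type*} [MeasurableSpace α] {μ : Measure α} {f g : α → U}
    (hf : MemLp f 2 μ) (hg : MemLp g 2 μ) :
    ‖∫ t, inner 𝕜 (f t) (g t) ∂μ‖ ≤ ‖hf.toLp f‖ * ‖hg.toLp g‖ := by
  have h1 : ∫ t, inner 𝕜 (f t) (g t) ∂μ = inner 𝕜 (hf.toLp f) (hg.toLp g) := by
    rw [L2.inner_def]
    refine integral_congr_ae ?_
    filter_upwards [hf.coeFn_toLp, hg.coeFn_toLp] with t h1 h2
    rw [h1, h2]
  rw [h1]
  exact norm_inner_le_norm _ _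

theorem intervalIntegrable_of_memLp_two {E : Type*} [NormedAddCommGroup E] {T : ℝ} (hT : 0 ≤ T)
    {g : ℝ → E} (hg : MemLp g 2 (volume.restrict (Ioo 0 T))) : IntervalIntegrable g volume 0 T := by
  rw [intervalIntegrable_iff_integrableOn_Ioo_of_le hT]
  exact hg.integrable (by norm_num)

theorem intervalIntegral_eq_integral_Ioo {E : Type*} [NormedAddCommGroup E] [NormedSpace ℝ E]
    {T : ℝ} (hT : 0 ≤ T) (g : ℝ → E) : ∫ t in (0 : ℝ)..T, g t = ∫ t in Ioo 0 T, g t := by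
  rw [intervalIntegral.integral_of_le hT, integral_Ioc_eq_integral_Ioo]

variable [NormedSpace ℝ U] [IsScalarTower ℝ 𝕜 U] [NormedSpace ℝ H] [IsScalarTower ℝ 𝕜 H]

/-- The observation map `z ↦ D exp (-(T - ·) A) z`, with values in `L²(0, T; U)`. -/
noncomputable def observationMap (T : ℝ) : H →ₗ[ℝ] Lp U 2 (volume.restrict (Ioo 0 T)) where
  toFun z := (memLp_observation b hlam D T z).toLp _
  map_add' z z' := by
    rw [← MemLp.toLp_add]
    congr 1
    ext t
    simp
  map_smul' c z := by
    rw [RingHom.id_apply, ← MemLp.toLp_const_smul]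
    congr 1
    ext t
    rw [Pi.smul_apply, ← algebraMap_smul 𝕜 c z, map_smul, map_smul, algebraMap_smul]

theorem coeFn_observationMap (T : ℝ) (z : H) :
    observationMap b hlam D T z =ᵐ[volume.restrict (Ioo 0 T)]
      fun t => D (heatOp b hlam (T - t) z) :=
  (memLp_observation b hlam D T z).coeFn_toLp

theorem norm_sq_observationMap {T : ℝ} (hT : 0 ≤ T) (z : H) :
    ‖observationMap b hlam D T z‖ ^ 2 = ∫ s in (0 : ℝ)..T, ‖D (heatOp b hlam s z)‖ ^ 2 := by
  have h1 : ‖observationMap b hlam D T z‖ ^ 2 =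
      ∫ t in Ioo 0 T, ‖observationMap b hlam D T z t‖ ^ 2 := by
    rw [norm_sq_eq_re_inner (𝕜 := 𝕜) (observationMap b hlam D T z), L2.inner_def,
      ← integral_re (L2.integrable_inner _ _)]
    simp only [← norm_sq_eq_re_inner]
  rw [h1, integral_congr_ae (g := fun t => ‖D (heatOp b hlam (T - t) z)‖ ^ 2),
    ← intervalIntegral_eq_integral_Ioo hT,
    intervalIntegral.integral_comp_sub_left (fun s => ‖D (heatOp b hlam s z)‖ ^ 2) T]
  · simp
  · filter_upwards [coeFn_observationMap b hlam D T z] with t ht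
    rw [ht]

theorem norm_observationMap_mono {τ T : ℝ} (hτ : 0 ≤ τ) (hT : τ ≤ T) (z : H) :
    ‖observationMap b hlam D τ z‖ ≤ ‖observationMap b hlam D T z‖ := by
  refine le_of_sq_le_sq ?_ (norm_nonneg _)
  rw [norm_sq_observationMap b hlam D hτ, norm_sq_observationMap b hlam D (hτ.trans hT)]
  refine intervalIntegral.integral_mono_interval le_rfl hτ hT
    (Eventually.of_forall fun s => sq_nonneg _) (Continuous.intervalIntegrable ?_ _ _)
  exact ((D.continuous.comp (continuous_heatOp b hlam z)).norm).pow 2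

/-- An element of the closure of the range of the observation map is still of the form
`t ↦ D (h (T - t))` where `h` follows the semigroup at positive times, although it need not have
a limit in `H` at time `0`. -/
theorem exists_trajectory_of_mem_closure [CompleteSpace H] {T : ℝ} (hT : 0 < T)
    (hobs : ∀ τ, 0 < τ → ∃ C, ∀ z, ‖heatOp b hlam τ z‖ ≤ C * ‖observationMap b hlam D τ z‖)
    {w : Lp U 2 (volume.restrict (Ioo 0 T))}
    (hw : w ∈ closure (range (observationMap b hlam D T))) :
    ∃ h : ℝ → H, (∀ r, 0 < r → ∀ s, r ≤ s → h s = heatOp b hlam (s - r) (h r)) ∧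
      ∀ᵐ t ∂(volume.restrict (Ioo 0 T)), w t = D (h (T - t)) := by
  obtain ⟨x, hx, hxw⟩ := mem_closure_iff_seq_limit.mp hw
  choose z hz using hx
  have hlim : ∀ s, 0 < s → ∃ y, Tendsto (fun n => heatOp b hlam s (z n)) atTop (𝓝 y) := by
    intro s hs
    -- Observability at time `τ ≤ T` makes `S(τ) zₙ` a Cauchy sequence, and `S(s - τ)` contracts.
    set τ := min s T with hτ
    have hτ0 : 0 < τ := lt_min hs hT
    obtain ⟨C, hC⟩ := hobs τ hτ0
    have hb : ∀ y, ‖heatOp b hlam s y‖ ≤ |C| * ‖observationMap b hlam D T y‖ := fun y => by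
      have h1 : heatOp b hlam s y = heatOp b hlam (s - τ) (heatOp b hlam τ y) := by
        rw [← heatOp_add b hlam (sub_nonneg.mpr (min_le_left _ _)) hτ0.le, sub_add_cancel]
      rw [h1]
      refine (norm_heatOp_le b hlam _ _).trans ((hC y).trans ?_)
      exact mul_le_mul (le_abs_self C)
        (norm_observationMap_mono b hlam D hτ0.le (min_le_right _ _) y) (norm_nonneg _)
        (abs_nonneg C)
    refine cauchySeq_tendsto_of_complete ?_
    have hcx := hxw.cauchySeq
    rw [Metric.cauchySeq_iff'] at hcx ⊢
    intro ε hε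
    obtain ⟨N, hN⟩ := hcx (ε / (|C| + 1)) (by positivity)
    refine ⟨N, fun n hn => ?_⟩
    have h2 := hN n hn
    rw [dist_eq_norm, ← hz, ← hz, ← map_sub, lt_div_iff₀ (by positivity)] at h2
    rw [dist_eq_norm, ← map_sub]
    refine (hb _).trans_lt (lt_of_le_of_lt ?_ h2)
    rw [mul_comm]
    gcongr
    linarith
  choose! h hh using hlim
  refine ⟨h, fun r hr s hs => ?_, ?_⟩
  · refine tendsto_nhds_unique (hh s (hr.trans_le hs)) ?_
    have h1 := ((heatOp b hlam (s - r)).continuous.tendsto _).comp (hh r hr)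
    refine h1.congr fun n => ?_
    rw [Function.comp_apply, ← heatOp_add b hlam (sub_nonneg.mpr hs) hr.le, sub_add_cancel]
  · obtain ⟨ns, hns, hae⟩ := (tendstoInMeasure_of_tendsto_Lp hxw).exists_seq_tendsto_ae
    have hall : ∀ᵐ t ∂(volume.restrict (Ioo 0 T)), ∀ n,
        x n t = D (heatOp b hlam (T - t) (z n)) := by
      rw [ae_all_iff]
      intro n
      rw [← hz n]
      exact coeFn_observationMap b hlam D T (z n)
    filter_upwards [hae, hall, ae_restrict_mem measurableSet_Ioo] with t h1 h2 ht
    refine tendsto_nhds_unique h1 ?_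
    simp only [h2]
    exact (D.continuous.tendsto _).comp
      ((hh (T - t) (sub_pos.mpr ht.2)).comp hns.tendsto_atTop)

theorem analyticOnNhd_trajectory [CompleteSpace H] {h : ℝ → H}
    (hh : ∀ r, 0 < r → ∀ s, r ≤ s → h s = heatOp b hlam (s - r) (h r)) :
    AnalyticOnNhd ℝ h (Ioi 0) := by
  intro s hs
  have hs : 0 < s := hs
  have h1 : AnalyticAt ℝ (fun r => heatOp b hlam (r - s / 2) (h (s / 2))) s := by
    have h2 := analyticOnNhd_heatOp b hlam (h (s / 2)) (s - s / 2)
      (by rw [mem_Ioi]; linarith)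
    exact h2.fun_comp (f := fun r : ℝ => r - s / 2) (by fun_prop)
  refine h1.congr ?_
  filter_upwards [lt_mem_nhds (show s / 2 < s by linarith)] with r hr
  exact (hh _ (by linarith) r hr.le).symm

end Observation

section Ties

open Filter Topology

theorem AnalyticOnNhd.norm_sq {G : Type*} [NormedAddCommGroup G] [InnerProductSpace ℝ G]
    {g : ℝ → G} {S : Set ℝ} (hg : AnalyticOnNhd ℝ g S) :
    AnalyticOnNhd ℝ (fun s => ‖g s‖ ^ 2) S := by
  intro s hs
  have h : AnalyticAt ℝ (fun x : G => ‖x‖ ^ 2) (g s) :=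
    ((contDiff_norm_sq ℝ).contDiffAt).analyticAt
  exact h.comp (hg s hs)

/-- If `g₁`, `g₂` are analytic on `(0, ∞)`, then `‖g₁ s‖² = (a - s) ‖g₂ s‖²` holds for almost no
`s > 0`, unless both functions vanish: the weight `a - s` is negative for large `s`. -/
theorem ae_ne_or_eq_zero_of_analytic {G₁ G₂ : Type*} [NormedAddCommGroup G₁]
    [InnerProductSpace ℝ G₁] [NormedAddCommGroup G₂] [InnerProductSpace ℝ G₂]
    {g₁ : ℝ → G₁} {g₂ : ℝ → G₂}
    (h₁ : AnalyticOnNhd ℝ g₁ (Ioi 0)) (h₂ : AnalyticOnNhd ℝ g₂ (Ioi 0)) (a : ℝ) :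
    (∀ᵐ s ∂(volume.restrict (Ioi 0)), ‖g₁ s‖ ^ 2 ≠ (a - s) * ‖g₂ s‖ ^ 2) ∨
      ∀ s ∈ Ioi (0 : ℝ), g₁ s = 0 ∧ g₂ s = 0 := by
  have hφ : AnalyticOnNhd ℝ (fun s => ‖g₁ s‖ ^ 2 - (a - s) * ‖g₂ s‖ ^ 2) (Ioi 0) :=
    fun s hs => (h₁.norm_sq s hs).sub ((by fun_prop : AnalyticAt ℝ (fun s => a - s) s).mul
      (h₂.norm_sq s hs))
  rcases hφ.eqOn_zero_or_eventually_ne_zero_of_preconnected isPreconnected_Ioi with h0 | hne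
  · right
    have hlarge : ∀ s ∈ Ioi (max a 0), g₁ s = 0 ∧ g₂ s = 0 := fun s hs => by
      obtain ⟨hsa, hs0⟩ := max_lt_iff.mp (mem_Ioi.mp hs)
      have h3 : ‖g₁ s‖ ^ 2 = (a - s) * ‖g₂ s‖ ^ 2 := sub_eq_zero.mp (h0 hs0)
      have h4 : 0 ≤ ‖g₁ s‖ ^ 2 := sq_nonneg _
      have h5 : ‖g₂ s‖ ^ 2 = 0 := by nlinarith [sq_nonneg ‖g₂ s‖]
      rw [h5, mul_zero] at h3
      simpa using And.intro h3 h5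
    have hmem : max a 0 + 1 ∈ Ioi (0 : ℝ) := by
      rw [mem_Ioi]; linarith [le_max_right a 0]
    have hnhds : Ioi (max a 0) ∈ 𝓝 (max a 0 + 1) := Ioi_mem_nhds (by linarith)
    have e₁ := h₁.eqOn_zero_of_preconnected_of_eventuallyEq_zero isPreconnected_Ioi hmem
      (by filter_upwards [hnhds] with s hs using (hlarge s hs).1)
    have e₂ := h₂.eqOn_zero_of_preconnected_of_eventuallyEq_zero isPreconnected_Ioi hmem
      (by filter_upwards [hnhds] with s hs using (hlarge s hs).2)
    exact fun s hs => ⟨e₁ hs, e₂ hs⟩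
  · left
    filter_upwards [ae_restrict_le_codiscreteWithin measurableSet_Ioi hne] with s hs
    exact fun h => hs (sub_eq_zero.mpr h)

end Ties

/-! ### Observability and duality -/

section Controllability

open SwitchingControl Filter

variable {ι 𝕜 H U : Type*} [RCLike 𝕜] [NormedAddCommGroup H] [InnerProductSpace 𝕜 H]
  [CompleteSpace H] [NormedAddCommGroup U] [InnerProductSpace 𝕜 U] [CompleteSpace U]
  {b : HilbertBasis ι 𝕜 H} {lam : ι → ℝ} {A : H →ₗ.[𝕜] H} {g : ℝ → H} {T : ℝ}
  [NormedSpace ℝ U] [IsScalarTower ℝ 𝕜 U] [NormedSpace ℝ H] [IsScalarTower ℝ 𝕜 H]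

/-- The duality between the controlled equation and the adjoint equation. -/
theorem inner_mildSolution_eq (hlam : ∀ i, 0 ≤ lam i) (hT : 0 ≤ T)
    (hg : IntervalIntegrable g volume 0 T) (y₀ z : H) :
    inner 𝕜 z (mildSolution b hlam g y₀ T) = inner 𝕜 (heatOp b hlam T z) y₀ +
      ∫ t in Ioo 0 T, inner 𝕜 (heatOp b hlam (T - t) z) (g t) := by
  rw [mildSolution, inner_add_right, ← heatOp_symmetric,
    inner_intervalIntegral (intervalIntegrable_heatOp b hlam hg T),
    intervalIntegral_eq_integral_Ioo hT]
  simp only [heatOp_symmetric]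

/-- Null-controllability in time `τ` yields the observability inequality at time `τ`. -/
theorem observability_of_nullControllable (hsa : A.adjoint = A) (hA : A.IsFormalAdjoint A)
    (hb : ∀ i, ∃ h : b i ∈ A.domain, A ⟨b i, h⟩ = (lam i : 𝕜) • b i) (hlam : ∀ i, 0 ≤ lam i)
    {B : U →L[𝕜] H} (hnull : NullControllableSmallTime A B) {τ : ℝ} (hτ : 0 < τ) :
    ∃ C, ∀ z, ‖heatOp b hlam τ z‖ ≤
      C * ‖observationMap b hlam (ContinuousLinearMap.adjoint B) τ z‖ := by
  obtain ⟨C, hC⟩ := hnull τ hτ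
  refine ⟨C, fun z => ?_⟩
  obtain ⟨u, hu, huC, hdrive⟩ := hC (heatOp b hlam τ z)
  have hBu : MemLp (fun t => B (u t)) 2 (volume.restrict (Ioo 0 τ)) := B.comp_memLp' hu
  have hint := intervalIntegrable_of_memLp_two hτ.le hBu
  rw [drivesToZero_iff hsa hA hb hlam hτ.le hint] at hdrive
  have h1 := inner_mildSolution_eq (b := b) hlam hτ.le hint (heatOp b hlam τ z) z
  rw [hdrive, inner_zero_right, inner_self_eq_norm_sq_to_K] at h1
  simp only [← ContinuousLinearMap.adjoint_inner_left] at h1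
  have h2 := norm_integral_inner_le (𝕜 := 𝕜)
    (memLp_observation b hlam (ContinuousLinearMap.adjoint B) τ z) hu
  have h3 : ‖hu.toLp u‖ ≤ C * ‖heatOp b hlam τ z‖ := by
    rw [Lp.norm_toLp]
    refine ENNReal.toReal_le_of_le_ofReal (by positivity) (huC.trans_eq ?_)
    rw [ENNReal.ofReal_mul (NNReal.coe_nonneg C), ofReal_norm, ENNReal.ofReal_coe_nnreal]
  rw [eq_neg_of_add_eq_zero_right h1.symm, norm_neg, norm_pow, RCLike.norm_ofReal, abs_norm] at h2
  change _ ≤ ‖observationMap b hlam (ContinuousLinearMap.adjoint B) τ z‖ * _ at h2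
  rcases (norm_nonneg (heatOp b hlam τ z)).eq_or_lt with h0 | hpos
  · rw [← h0]
    positivity
  · refine le_of_mul_le_mul_right ?_ hpos
    calc _ = ‖heatOp b hlam τ z‖ ^ 2 := (sq _).symm
      _ ≤ ‖observationMap b hlam (ContinuousLinearMap.adjoint B) τ z‖ *
          (C * ‖heatOp b hlam τ z‖) := h2.trans (by gcongr)
      _ = _ := by ring

theorem eLpNorm_two_sq {α E : Type*} [MeasurableSpace α] [NormedAddCommGroup E] {μ : Measure α}
    (f : α → E) : eLpNorm f 2 μ ^ 2 = ∫⁻ t, ‖f t‖ₑ ^ 2 ∂μ := by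
  simpa using eLpNorm_nnreal_pow_eq_lintegral (f := f) (μ := μ) (p := 2) two_ne_zero

theorem enorm_smul_sq {E : Type*} [NormedAddCommGroup E] [InnerProductSpace 𝕜 E] (c : ℝ) (x : E) :
    ‖(c : 𝕜) • x‖ₑ ^ 2 = ENNReal.ofReal (c ^ 2) * ‖x‖ₑ ^ 2 := by
  rw [enorm_smul, mul_pow, ← ofReal_norm (c : 𝕜), RCLike.norm_ofReal,
    ← ENNReal.ofReal_pow (abs_nonneg c), sq_abs]

/-- Cauchy–Schwarz with the weights `ρ` and `1 / ρ`. -/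
theorem exists_norm_integral_inner_le {E : Type*} [NormedAddCommGroup E]
    [InnerProductSpace 𝕜 E] {α : Type*} [MeasurableSpace α] {μ : Measure α} {ρ : α → ℝ} {f : α → E}
    (hρm : AEStronglyMeasurable ρ μ) (hρ : ∀ᵐ t ∂μ, 0 < ρ t) (hf : AEStronglyMeasurable f μ)
    (hfρ : ∫⁻ t, ENNReal.ofReal (1 / ρ t ^ 2) * ‖f t‖ₑ ^ 2 ∂μ < ∞) :
    ∃ C : ℝ, 0 ≤ C ∧ ∀ (z : α → E) (r : ℝ), AEStronglyMeasurable z μ → 0 ≤ r →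
      ∫⁻ t, ENNReal.ofReal (ρ t ^ 2) * ‖z t‖ₑ ^ 2 ∂μ ≤ ENNReal.ofReal (r ^ 2) →
      ‖∫ t, inner 𝕜 (z t) (f t) ∂μ‖ ≤ C * r := by
  have hρm' : AEStronglyMeasurable (fun t => ((ρ t)⁻¹ : ℝ)) μ :=
    hρm.aemeasurable.inv.aestronglyMeasurable
  have hF : MemLp (fun t => (((ρ t)⁻¹ : ℝ) : 𝕜) • f t) 2 μ := by
    refine ⟨(RCLike.continuous_ofReal.comp_aestronglyMeasurable hρm').smul hf, ?_⟩
    refine (ENNReal.pow_lt_top_iff (n := 2).mp ?_).resolve_right two_ne_zero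
    rw [eLpNorm_two_sq]
    simp only [enorm_smul_sq]
    simpa using hfρ
  refine ⟨‖hF.toLp _‖, norm_nonneg _, fun z r hz hr hle => ?_⟩
  have hle' : eLpNorm (fun t => (ρ t : 𝕜) • z t) 2 μ ≤ ENNReal.ofReal r := by
    rw [← ENNReal.pow_le_pow_left_iff two_ne_zero, eLpNorm_two_sq, ← ENNReal.ofReal_pow hr]
    simpa only [enorm_smul_sq] using hle
  have hZ : MemLp (fun t => (ρ t : 𝕜) • z t) 2 μ :=
    ⟨(RCLike.continuous_ofReal.comp_aestronglyMeasurable hρm).smul hz,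
      hle'.trans_lt ENNReal.ofReal_lt_top⟩
  have heq : ∫ t, inner 𝕜 (z t) (f t) ∂μ =
      ∫ t, inner 𝕜 ((ρ t : 𝕜) • z t) ((((ρ t)⁻¹ : ℝ) : 𝕜) • f t) ∂μ := by
    refine integral_congr_ae ?_
    filter_upwards [hρ] with t ht
    rw [inner_smul_left, inner_smul_right, RCLike.conj_ofReal, ← mul_assoc, ← RCLike.ofReal_mul,
      mul_inv_cancel₀ ht.ne', RCLike.ofReal_one, one_mul]
  rw [heq]
  refine (norm_integral_inner_le hZ hF).trans ?_
  rw [mul_comm]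
  gcongr
  rw [Lp.norm_toLp]
  exact ENNReal.toReal_le_of_le_ofReal hr hle'

/-- The pairing of an adjoint final datum `z` with the uncontrolled final state is bounded by the
observation of `z`: the contribution of `y₀` by null-controllability, that of the source `f` by the
weighted observability inequality. -/
theorem exists_norm_inner_mildSolution_le (hsa : A.adjoint = A) (hA : A.IsFormalAdjoint A)
    (hb : ∀ i, ∃ h : b i ∈ A.domain, A ⟨b i, h⟩ = (lam i : 𝕜) • b i) (hlam : ∀ i, 0 ≤ lam i)
    {B : U →L[𝕜] H} (hnull : NullControllableSmallTime A B) (hT : 0 < T) {ρ : ℝ → ℝ}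
    (hρm : AEStronglyMeasurable ρ (volume.restrict (Ioo 0 T)))
    (hρ : ∀ᵐ t ∂(volume.restrict (Ioo 0 T)), 0 < ρ t) (hobs : WeightedObservability A B T ρ)
    {f : ℝ → H} (hf : MemLp f 2 (volume.restrict (Ioo 0 T)))
    (hfρ : ∫⁻ t in Ioo 0 T, ENNReal.ofReal (1 / ρ t ^ 2) * ‖f t‖ₑ ^ 2 < ∞) (y₀ : H) :
    ∃ C : ℝ, ∀ z, ‖inner 𝕜 z (mildSolution b hlam f y₀ T)‖ ≤
      C * ‖observationMap b hlam (ContinuousLinearMap.adjoint B) T z‖ := by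
  obtain ⟨C₁, hC₁⟩ := observability_of_nullControllable hsa hA hb hlam hnull hT
  obtain ⟨C₂, -, hC₂⟩ := exists_norm_integral_inner_le (𝕜 := 𝕜) hρm hρ hf.aestronglyMeasurable hfρ
  refine ⟨C₁ * ‖y₀‖ + C₂, fun z => ?_⟩
  rw [inner_mildSolution_eq hlam hT.le (intervalIntegrable_of_memLp_two hT.le hf), add_mul]
  refine (norm_add_le _ _).trans (add_le_add ?_ ?_)
  · refine (norm_inner_le_norm _ _).trans ?_
    rw [mul_right_comm]
    gcongr
    exact hC₁ z
  · have hz : Continuous fun t => heatOp b hlam (T - t) z :=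
      (continuous_heatOp b hlam z).comp (by fun_prop)
    refine hC₂ _ _ hz.aestronglyMeasurable (norm_nonneg _) ?_
    refine (hobs z _ (isAdjointSolution_heatOp hsa hA hb hlam z)).trans_eq ?_
    rw [ENNReal.ofReal_pow (norm_nonneg _), ofReal_norm, ← eLpNorm_two_sq]
    congr 1
    exact (Lp.enorm_toLp (hf := memLp_observation b hlam _ T z)).symm

theorem real_inner_eq_re {E : Type*} [NormedAddCommGroup E] [InnerProductSpace 𝕜 E]
    [InnerProductSpace ℝ E] (x y : E) : inner ℝ x y = RCLike.re (inner 𝕜 x y) := by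
  rw [real_inner_eq_norm_add_mul_self_sub_norm_mul_self_sub_norm_mul_self_div_two,
    re_inner_eq_norm_add_mul_self_sub_norm_mul_self_sub_norm_mul_self_div_two]

end Controllability

/-! ### Switching controls -/

section SwitchingControls

open SwitchingControl Filter Topology

variable {ι 𝕜 H U U₁ U₂ : Type*} [RCLike 𝕜]
  [NormedAddCommGroup H] [InnerProductSpace 𝕜 H] [CompleteSpace H]
  [NormedAddCommGroup U] [InnerProductSpace 𝕜 U]
  [NormedAddCommGroup U₁] [InnerProductSpace 𝕜 U₁]
  [NormedAddCommGroup U₂] [InnerProductSpace 𝕜 U₂]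
  [NormedSpace ℝ H] [IsScalarTower ℝ 𝕜 H]
  {b : HilbertBasis ι 𝕜 H} {lam : ι → ℝ} {T : ℝ}

variable [InnerProductSpace ℝ U] [IsScalarTower ℝ 𝕜 U] [InnerProductSpace ℝ U₁]
  [IsScalarTower ℝ 𝕜 U₁] [InnerProductSpace ℝ U₂] [IsScalarTower ℝ 𝕜 U₂]

/-- No element of the closure of the observation space has ties between its two weighted
components on a set of positive measure, unless both components vanish identically. -/
theorem ae_no_tie_of_mem_closure (hlam : ∀ i, 0 ≤ lam i) {D : H →L[𝕜] U} (hT : 0 < T)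
    (hobs : ∀ τ, 0 < τ → ∃ C, ∀ z, ‖heatOp b hlam τ z‖ ≤ C * ‖observationMap b hlam D τ z‖)
    (P₁ : U →L[𝕜] U₁) (P₂ : U →L[𝕜] U₂) {w : Lp U 2 (volume.restrict (Ioo 0 T))}
    (hw : w ∈ closure (range (observationMap b hlam D T))) :
    ∀ᵐ t ∂(volume.restrict (Ioo 0 T)),
      ‖P₁ (w t)‖ ^ 2 ≠ (T + t) * ‖P₂ (w t)‖ ^ 2 ∨ (P₁ (w t) = 0 ∧ P₂ (w t) = 0) := by
  obtain ⟨h, hh, hwh⟩ := exists_trajectory_of_mem_closure b hlam D hT hobs hw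
  have han := analyticOnNhd_trajectory b hlam hh
  have h₁ : AnalyticOnNhd ℝ (fun s => P₁ (D (h s))) (Ioi 0) :=
    ((P₁ ∘L D).restrictScalars ℝ).comp_analyticOnNhd han
  have h₂ : AnalyticOnNhd ℝ (fun s => P₂ (D (h s))) (Ioi 0) :=
    ((P₂ ∘L D).restrictScalars ℝ).comp_analyticOnNhd han
  rcases ae_ne_or_eq_zero_of_analytic h₁ h₂ (2 * T) with hae | hzero
  · -- Transfer along the reflection `t ↦ s = T - t`, under which `2 T - s = T + t`.
    rw [ae_restrict_iff' measurableSet_Ioi] at hae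
    have hae' := (Measure.measurePreserving_sub_left volume T).quasiMeasurePreserving.ae hae
    filter_upwards [hwh, ae_restrict_of_ae hae', ae_restrict_mem measurableSet_Ioo] with t e1 e2 ht
    left
    rw [e1]
    have e3 := e2 (sub_pos.mpr ht.2)
    rwa [show 2 * T - (T - t) = T + t by ring] at e3
  · filter_upwards [hwh, ae_restrict_mem measurableSet_Ioo] with t e1 ht
    right
    rw [e1]
    exact hzero _ (sub_pos.mpr ht.2)

/-- Switching controls for a diagonal operator, in terms of the two components `P₁ B*`, `P₂ B*` of
the observation. -/
theorem exists_switching_controls [CompleteSpace U] {A : H →ₗ.[𝕜] H} (hsa : A.adjoint = A)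
    (hA : A.IsFormalAdjoint A)
    (hb : ∀ i, ∃ h : b i ∈ A.domain, A ⟨b i, h⟩ = (lam i : 𝕜) • b i) (hlam : ∀ i, 0 ≤ lam i)
    {B : U →L[𝕜] H} (hnull : NullControllableSmallTime A B) (hT : 0 < T) {ρ : ℝ → ℝ}
    (hρm : AEStronglyMeasurable ρ (volume.restrict (Ioo 0 T)))
    (hρ : ∀ᵐ t ∂(volume.restrict (Ioo 0 T)), 0 < ρ t) (hobs : WeightedObservability A B T ρ)
    {f : ℝ → H} (hf : MemLp f 2 (volume.restrict (Ioo 0 T)))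
    (hfρ : ∫⁻ t in Ioo 0 T, ENNReal.ofReal (1 / ρ t ^ 2) * ‖f t‖ₑ ^ 2 < ∞) (y₀ : H)
    {B₁ : U₁ →L[𝕜] H} {B₂ : U₂ →L[𝕜] H} (P₁ : U →L[𝕜] U₁) (P₂ : U →L[𝕜] U₂)
    (hB₁ : ∀ x v, inner 𝕜 (P₁ (ContinuousLinearMap.adjoint B x)) v = inner 𝕜 x (B₁ v))
    (hB₂ : ∀ x v, inner 𝕜 (P₂ (ContinuousLinearMap.adjoint B x)) v = inner 𝕜 x (B₂ v))
    {c : ℝ} (hc : 0 < c) (hP : ∀ x, ‖x‖ ^ 2 ≤ c * max (‖P₁ x‖ ^ 2) (T * ‖P₂ x‖ ^ 2)) :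
    ∃ (u₁ : ℝ → U₁) (u₂ : ℝ → U₂),
      MemLp u₁ 2 (volume.restrict (Ioo 0 T)) ∧ MemLp u₂ 2 (volume.restrict (Ioo 0 T)) ∧
      (∀ t, ‖u₁ t‖ * ‖u₂ t‖ = 0) ∧
      DrivesToZero A T (fun t => B₁ (u₁ t) + B₂ (u₂ t) + f t) y₀ := by
  set D := ContinuousLinearMap.adjoint B
  set m := mildSolution b hlam f y₀ T with hm
  have hobs' : ∀ τ, 0 < τ → ∃ C, ∀ z, ‖heatOp b hlam τ z‖ ≤ C * ‖observationMap b hlam D τ z‖ :=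
    fun τ hτ => observability_of_nullControllable hsa hA hb hlam hnull hτ
  obtain ⟨C, hC⟩ := exists_norm_inner_mildSolution_le hsa hA hb hlam hnull hT hρm hρ hobs hf hfρ y₀
  have hsmul : ∀ (r : ℝ) (z : H), RCLike.re (inner 𝕜 (r • z) m) = r * RCLike.re (inner 𝕜 z m) :=
    fun r z => by
      rw [← algebraMap_smul 𝕜 r z, RCLike.algebraMap_eq_ofReal, inner_smul_left,
        RCLike.conj_ofReal, RCLike.re_ofReal_mul]
  obtain ⟨L, hL⟩ := exists_dual_of_le_norm (observationMap b hlam D T)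
    { toFun := fun z => -RCLike.re (inner 𝕜 z m)
      map_add' := fun z z' => by rw [inner_add_left, map_add, neg_add]
      map_smul' := fun r z => by
        rw [hsmul, RingHom.id_apply, smul_eq_mul, mul_neg] } (C := C)
    (fun z => by
      rw [LinearMap.coe_mk, AddHom.coe_mk, abs_neg]
      exact (RCLike.abs_re_le_norm _).trans (hC z))
  -- The weight `T + t`, truncated outside of `(0, T)`.
  set η : ℝ → ℝ := fun t => max T (min (2 * T) (T + t)) with hη
  have hηT : ∀ t ∈ Ioo 0 T, η t = T + t := fun t ht => by
    rw [hη]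
    simp only
    rw [min_eq_right (by linarith [ht.2]), max_eq_right (by linarith [ht.1])]
  obtain ⟨u₁, u₂, hu₁, hu₂, hsw, hrep⟩ := exists_switching_representation
    (μ := volume.restrict (Ioo 0 T)) (P₁ := P₁.restrictScalars ℝ) (P₂ := P₂.restrictScalars ℝ)
    (η := η) (δ := T) (M := 2 * T) (by fun_prop) hT.le
    (fun t => ⟨le_max_left _ _, max_le (by linarith) (min_le_left _ _)⟩) hc hP
    (LinearMap.range (observationMap b hlam D T)).topologicalClosure
    (Submodule.isClosed_topologicalClosure _)
    (fun w hw => by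
      filter_upwards [ae_no_tie_of_mem_closure hlam hT hobs' P₁ P₂ (w := w) hw,
        ae_restrict_mem measurableSet_Ioo] with t h1 ht
      rw [hηT t ht]
      exact h1) L
  refine ⟨u₁, u₂, hu₁, hu₂, hsw, ?_⟩
  have hg : IntervalIntegrable (fun t => B₁ (u₁ t) + B₂ (u₂ t)) volume 0 T :=
    intervalIntegrable_of_memLp_two hT.le ((B₁.comp_memLp' hu₁).add (B₂.comp_memLp' hu₂))
  have hfi := intervalIntegrable_of_memLp_two hT.le hf
  rw [drivesToZero_iff hsa hA hb hlam hT.le (hg.add hfi), mildSolution_add b hlam hg hfi]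
  -- The final state is orthogonal to every `z`, in particular to itself.
  have key : ∀ z, RCLike.re (inner 𝕜 z
      (mildSolution b hlam (fun t => B₁ (u₁ t) + B₂ (u₂ t)) 0 T + m)) = 0 := fun z => by
    have hint : Integrable (fun t => inner 𝕜 (heatOp b hlam (T - t) z)
        (B₁ (u₁ t) + B₂ (u₂ t))) (volume.restrict (Ioo 0 T)) := by
      simp only [heatOp_symmetric]
      exact (innerSL 𝕜 z).integrable_comp
        ((intervalIntegrable_iff_integrableOn_Ioo_of_le hT.le).mp
          (intervalIntegrable_heatOp b hlam hg T))
    rw [inner_add_right, inner_mildSolution_eq hlam hT.le hg, inner_zero_right, zero_add, map_add,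
      ← integral_re hint]
    have h1 := hrep _ (Submodule.le_topologicalClosure _ ⟨z, rfl⟩)
    rw [hL] at h1
    have h2 : ∫ t in Ioo 0 T, RCLike.re (inner 𝕜 (heatOp b hlam (T - t) z)
        (B₁ (u₁ t) + B₂ (u₂ t))) = -RCLike.re (inner 𝕜 z m) := by
      refine Eq.trans (integral_congr_ae ?_) h1
      filter_upwards [coeFn_observationMap b hlam D T z] with t ht
      rw [ht, inner_add_right, ← hB₁, ← hB₂, map_add, real_inner_comm _ (u₁ t),
        real_inner_comm _ (u₂ t),
        real_inner_eq_re (𝕜 := 𝕜), real_inner_eq_re (𝕜 := 𝕜)]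
      rfl
    rw [h2, neg_add_cancel]
  have h0 := key (mildSolution b hlam (fun t => B₁ (u₁ t) + B₂ (u₂ t)) 0 T + m)
  rw [inner_self_eq_norm_sq] at h0
  simpa using h0

end SwitchingControls

theorem isScalarTower_rclikeToReal (𝕜 E : Type*) [RCLike 𝕜] [NormedAddCommGroup E]
    [InnerProductSpace 𝕜 E] :
    letI := InnerProductSpace.rclikeToReal 𝕜 E
    IsScalarTower ℝ 𝕜 E := by
  let := InnerProductSpace.rclikeToReal 𝕜 E
  refine ⟨fun r c x => ?_⟩
  change (r • c) • x = (r : 𝕜) • c • x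
  rw [smul_smul, RCLike.real_smul_eq_coe_mul]

/-- An isomorphism from a product with components `j₁`, `j₂` dualizes to a lower bound on the
adjoints of the components. -/
theorem exists_norm_sq_le_max_adjoint {𝕜 U U₁ U₂ : Type*} [RCLike 𝕜]
    [NormedAddCommGroup U] [InnerProductSpace 𝕜 U] [CompleteSpace U]
    [NormedAddCommGroup U₁] [InnerProductSpace 𝕜 U₁] [CompleteSpace U₁]
    [NormedAddCommGroup U₂] [InnerProductSpace 𝕜 U₂] [CompleteSpace U₂]
    (π : (U₁ × U₂) ≃L[𝕜] U) {δ : ℝ} (hδ : 0 < δ) :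
    ∃ c : ℝ, 0 < c ∧ ∀ x, ‖x‖ ^ 2 ≤ c * max
      (‖ContinuousLinearMap.adjoint ((π : (U₁ × U₂) →L[𝕜] U) ∘L
        ContinuousLinearMap.inl 𝕜 U₁ U₂) x‖ ^ 2)
      (δ * ‖ContinuousLinearMap.adjoint ((π : (U₁ × U₂) →L[𝕜] U) ∘L
        ContinuousLinearMap.inr 𝕜 U₁ U₂) x‖ ^ 2) := by
  set Q₁ := ContinuousLinearMap.adjoint ((π : (U₁ × U₂) →L[𝕜] U) ∘L
    ContinuousLinearMap.inl 𝕜 U₁ U₂)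
  set Q₂ := ContinuousLinearMap.adjoint ((π : (U₁ × U₂) →L[𝕜] U) ∘L
    ContinuousLinearMap.inr 𝕜 U₁ U₂)
  set N := ‖(π.symm : U →L[𝕜] U₁ × U₂)‖ with hN
  have hx : ∀ x, ‖x‖ ≤ N * (‖Q₁ x‖ + ‖Q₂ x‖) := fun x => by
    rcases (norm_nonneg x).eq_or_lt with h0 | hpos
    · rw [← h0]; positivity
    refine le_of_mul_le_mul_right ?_ hpos
    have h1 : inner 𝕜 x x = inner 𝕜 (Q₁ x) (π.symm x).1 + inner 𝕜 (Q₂ x) (π.symm x).2 := by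
      rw [ContinuousLinearMap.adjoint_inner_left, ContinuousLinearMap.adjoint_inner_left,
        ← inner_add_right]
      congr 1
      simp [← map_add]
    have h2 : ‖π.symm x‖ ≤ N * ‖x‖ := (π.symm : U →L[𝕜] U₁ × U₂).le_opNorm x
    have h3 : ‖x‖ * ‖x‖ = ‖(inner 𝕜 x x : 𝕜)‖ := by
      rw [inner_self_eq_norm_sq_to_K, norm_pow, RCLike.norm_ofReal, abs_norm, sq]
    rw [h3, h1]
    calc _ ≤ ‖Q₁ x‖ * ‖(π.symm x).1‖ + ‖Q₂ x‖ * ‖(π.symm x).2‖ :=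
          (norm_add_le _ _).trans (add_le_add (norm_inner_le_norm _ _) (norm_inner_le_norm _ _))
      _ ≤ ‖Q₁ x‖ * (N * ‖x‖) + ‖Q₂ x‖ * (N * ‖x‖) := by
          gcongr
          · exact (norm_fst_le _).trans h2
          · exact (norm_snd_le _).trans h2
      _ = _ := by ring
  refine ⟨2 * N ^ 2 * (1 + 1 / δ) + 1, by positivity, fun x => ?_⟩
  set M := max (‖Q₁ x‖ ^ 2) (δ * ‖Q₂ x‖ ^ 2) with hM
  have hM0 : 0 ≤ M := (sq_nonneg _).trans (le_max_left _ _)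
  have e1 : ‖Q₁ x‖ ^ 2 ≤ M := le_max_left _ _
  have e2 : ‖Q₂ x‖ ^ 2 ≤ 1 / δ * M := by
    rw [one_div, le_inv_mul_iff₀ hδ]; exact le_max_right _ _
  calc ‖x‖ ^ 2 ≤ (N * (‖Q₁ x‖ + ‖Q₂ x‖)) ^ 2 := by gcongr; exact hx x
    _ = N ^ 2 * (‖Q₁ x‖ + ‖Q₂ x‖) ^ 2 := mul_pow _ _ _
    _ ≤ N ^ 2 * (2 * (‖Q₁ x‖ ^ 2 + ‖Q₂ x‖ ^ 2)) := by gcongr; exact add_sq_le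
    _ ≤ N ^ 2 * (2 * (M + 1 / δ * M)) := by gcongr
    _ ≤ _ := by nlinarith


theorem theorem6p2 {𝕜 H U U₁ U₂ : Type*} [RCLike 𝕜]
    [NormedAddCommGroup H] [InnerProductSpace 𝕜 H] [CompleteSpace H]
    [NormedAddCommGroup U] [InnerProductSpace 𝕜 U] [CompleteSpace U]
    [NormedAddCommGroup U₁] [InnerProductSpace 𝕜 U₁] [CompleteSpace U₁]
    [NormedAddCommGroup U₂] [InnerProductSpace 𝕜 U₂] [CompleteSpace U₂]
    (A : H →ₗ.[𝕜] H) (hA_sa : IsSelfAdjoint A)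
    (hA_pos : SwitchingControl.IsPosDef A) (hA_res : SwitchingControl.HasCompactResolvent A)
    (B : U →L[𝕜] H) (π : (U₁ × U₂) ≃L[𝕜] U) (B₁ : U₁ →L[𝕜] H) (B₂ : U₂ →L[𝕜] H)
    (hB : ∀ (v₁ : U₁) (v₂ : U₂), B (π (v₁, v₂)) = B₁ v₁ + B₂ v₂)
    (hnull : SwitchingControl.NullControllableSmallTime A B)
    (ρ : ℝ → ℝ → ℝ)
    (hρ_loc : ∀ T : ℝ, 0 < T → LocallyIntegrableOn (ρ T) (Ioo 0 T))
    (hρ_pos : ∀ T : ℝ, 0 < T → ∀ᵐ t ∂(volume.restrict (Ioo 0 T)), 0 < ρ T t)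
    (hρ_obs : ∀ T : ℝ, 0 < T → SwitchingControl.WeightedObservability A B T (ρ T))
    (T : ℝ) (hT : 0 < T) (y₀ : H) (f : ℝ → H)
    (hf : MemLp f 2 (volume.restrict (Ioo 0 T)))
    (hfρ : ∫⁻ t in Ioo 0 T, ENNReal.ofReal (1 / ρ T t ^ 2) * ‖f t‖ₑ ^ 2 < ∞) :
    ∃ (u₁ : ℝ → U₁) (u₂ : ℝ → U₂),
      MemLp u₁ 2 (volume.restrict (Ioo 0 T)) ∧
      MemLp u₂ 2 (volume.restrict (Ioo 0 T)) ∧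
      (∀ᵐ t ∂(volume.restrict (Ioo 0 T)), ‖u₁ t‖ * ‖u₂ t‖ = 0) ∧
      SwitchingControl.DrivesToZero A T (fun t => B₁ (u₁ t) + B₂ (u₂ t) + f t) y₀ := by
  have hsa : A.adjoint = A := hA_sa
  have hA : A.IsFormalAdjoint A := by
    have h := LinearPMap.adjoint_isFormalAdjoint hA_sa.dense_domain
    rwa [hsa] at h
  obtain ⟨ι, b, lam, hlam, hb⟩ := exists_hilbertBasis_eigenvalues hA hA_pos hA_res
  let := NormedSpace.restrictScalars ℝ 𝕜 H
  let := InnerProductSpace.rclikeToReal 𝕜 U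
  let := InnerProductSpace.rclikeToReal 𝕜 U₁
  let := InnerProductSpace.rclikeToReal 𝕜 U₂
  have := isScalarTower_rclikeToReal 𝕜 H
  have := isScalarTower_rclikeToReal 𝕜 U
  have := isScalarTower_rclikeToReal 𝕜 U₁
  have := isScalarTower_rclikeToReal 𝕜 U₂
  obtain ⟨c, hc, hP⟩ := exists_norm_sq_le_max_adjoint π hT
  obtain ⟨u₁, u₂, hu₁, hu₂, hsw, hdrive⟩ := exists_switching_controls hsa hA hb
    (fun i => (hlam i).le) hnull hT
    ((hρ_loc T hT).aestronglyMeasurable) (hρ_pos T hT) (hρ_obs T hT) hf hfρ y₀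
    (B₁ := B₁) (B₂ := B₂) _ _
    (fun x v => by
      rw [ContinuousLinearMap.adjoint_inner_left, ContinuousLinearMap.adjoint_inner_left]
      have := hB v 0
      simp_all)
    (fun x v => by
      rw [ContinuousLinearMap.adjoint_inner_left, ContinuousLinearMap.adjoint_inner_left]
      have := hB 0 v
      simp_all) hc hP
  exact ⟨u₁, u₂, hu₁, hu₂, Filter.Eventually.of_forall hsw, hdrive⟩
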